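/- Work in an arbitrary countably saturated nonstandard universe (a star map on the standard objects of finite type over $\mathbb N$ satisfying the transfer principle and such that every countable family of internal sets with the finite intersection property has nonempty intersection). *Borel* subsets of an internal set are the members of the least $\sigma$-algebra containing all its internal subsets. A set is *countably determined* (CD) if it has the form $$\bigcup_{b\in B}\Bigl(\bigcap_{m\in b}X_m\cap\bigcap_{m\in\mathbb N\setminus b}\bigl(\textstyle\bigcup_n X_n\setminus X_m\bigr)\Bigr)$$ with all $X_m$ ($m\in\mathbb N$) internal and $B\subseteq\mathcal P(\mathbb N)$. For equivalence relations $\mathsf E,\mathsf F$ on sets $X,Y$, write $\mathsf E\le_B\mathsf F$ (resp. $\mathsf E\le_{CD}\mathsf F$) if there is a map $\vartheta:X\to Y$ with Borel (resp. CD) graph such that $x\,\mathsf E\,x'\iff\vartheta(x)\,\mathsf F\,\vartheta(x')$ for all $x,x'\in X$; write $\mathsf E<_B\mathsf F$ if $\mathsf E\le_B\mathsf F$ and not $\mathsf F\le_B\mathsf E$. A set $U\subseteq{}^*\mathbb N$ is a *countably cofinal* (resp. *countably coinitial*) cut if $U=\bigcup_{n\in\mathbb N}[0,a_n)$ for a strictly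 increasing (resp. $U=\bigcap_{n\in\mathbb N}[0,a_n)$ for a strictly decreasing) sequence $(a_n)_{n\in\mathbb N}$ in ${}^*\mathbb N$; it is *additive* if $x+y\in U$ whenever $x,y\in U$. For an additive cut $U$ let $\mathsf E_U$ be the equivalence relation on ${}^*\mathbb N$ given by $x\,\mathsf E_U\,y\iff|x-y|\in U$. Let $\mathsf{FD}$ be the equivalence relation on the set of all hyperfinite (internal) subsets of ${}^*\mathbb N$ given by $u\,\mathsf{FD}\,v\iff u\,\triangle\,v$ is finite. Then: 1. if $U\subseteq{}^*\mathbb N$ is an additive countably cofinal cut, then $\mathsf E_U\le_B\mathsf{FD}$, and moreover $\mathsf E_U<_B\mathsf{FD}$; 2. if $V\subseteq{}^*\mathbb N$ is an additive countably coinitial cut, then $\mathsf E_V\not\le_{CD}\mathsf{FD}$. -/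

import Mathlib

universe u

/-! ## Nonstandard universes

The finite types over `ℕ` (natural numbers, sets, ordered pairs), the first-order language of
membership and ordered pairs over them (every quantifier ranges over one finite type, that is, it is
a bounded quantifier), and countably saturated nonstandard universes: a star map from the standard
objects of all finite types to the internal ones that satisfies transfer and countable saturation. -/

namespace NSA

/-- Finite types over `ℕ`. -/
inductive Ty : Type
  | nat : Ty
  | set : Ty → Ty
  | prod : Ty → Ty → Ty

/-- The standard objects of a given finite type. -/
@[reducible] def Ty.Std : Ty → Type
  | .nat => ℕ
  | .set τ => Set τ.Std
  | .prod σ τ => σ.Std × τ.Std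

/-- Variables (de Bruijn indices) of type `τ` in a context. -/
inductive Var : List Ty → Ty → Type
  | zero {Γ : List Ty} {τ : Ty} : Var (τ :: Γ) τ
  | succ {Γ : List Ty} {σ τ : Ty} : Var Γ τ → Var (σ :: Γ) τ

/-- Terms: variables, constants for all standard objects, ordered pairs. -/
inductive Term (Γ : List Ty) : Ty → Type
  | var {τ : Ty} : Var Γ τ → Term Γ τ
  | const {τ : Ty} : τ.Std → Term Γ τ
  | pair {σ τ : Ty} : Term Γ σ → Term Γ τ → Term Γ (.prod σ τ)

/-- Formulas of the language of membership with variables from the context `Γ`. -/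
inductive Formula : List Ty → Type
  | eq {Γ : List Ty} {τ : Ty} : Term Γ τ → Term Γ τ → Formula Γ
  | mem {Γ : List Ty} {τ : Ty} : Term Γ τ → Term Γ (.set τ) → Formula Γ
  | neg {Γ : List Ty} : Formula Γ → Formula Γ
  | and {Γ : List Ty} : Formula Γ → Formula Γ → Formula Γ
  | or {Γ : List Ty} : Formula Γ → Formula Γ → Formula Γ
  | imp {Γ : List Ty} : Formula Γ → Formula Γ → Formula Γ
  | all {Γ : List Ty} (τ : Ty) : Formula (τ :: Γ) → Formula Γ
  | ex {Γ : List Ty} (τ : Ty) : Formula (τ :: Γ) → Formula Γ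

/-- An interpretation of the language. -/
structure Interp where
  /-- the objects of each finite type -/
  Obj : Ty → Type u
  /-- the value of the constant for a standard object -/
  star : {τ : Ty} → τ.Std → Obj τ
  /-- membership -/
  mem : {τ : Ty} → Obj τ → Obj (.set τ) → Prop
  /-- ordered pairs -/
  pair : {σ τ : Ty} → Obj σ → Obj τ → Obj (.prod σ τ)

/-- The standard interpretation. -/
def standard : Interp.{0} where
  Obj := Ty.Std
  star := fun x => x
  mem := fun {τ} (x : τ.Std) (A : Set τ.Std) => x ∈ A
  pair := fun x y => (x, y)

/-- Assignments of values to the variables of a context. -/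
def Env (M : Interp.{u}) (Γ : List Ty) : Type u := (τ : Ty) → Var Γ τ → M.Obj τ

/-- The assignment to the empty context. -/
def Env.nil (M : Interp.{u}) : Env M [] := fun _ i => nomatch i

/-- Extension of an assignment by a value of a new variable. -/
def Env.cons {M : Interp.{u}} {Γ : List Ty} {σ : Ty} (x : M.Obj σ) (v : Env M Γ) :
    Env M (σ :: Γ)
  | _, .zero => x
  | τ, .succ i => v τ i

/-- The value of a term. -/
def Term.eval {M : Interp.{u}} {Γ : List Ty} (v : Env M Γ) : {τ : Ty} → Term Γ τ → M.Obj τ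
  | τ, .var i => v τ i
  | _, .const c => M.star c
  | _, .pair s t => M.pair (s.eval v) (t.eval v)

/-- Tarski's definition of truth of a formula under an assignment. -/
def Formula.Holds (M : Interp.{u}) : {Γ : List Ty} → Formula Γ → Env M Γ → Prop
  | _, .eq s t, v => s.eval v = t.eval v
  | _, .mem s t, v => M.mem (s.eval v) (t.eval v)
  | _, .neg φ, v => ¬ φ.Holds M v
  | _, .and φ ψ, v => φ.Holds M v ∧ ψ.Holds M v
  | _, .or φ ψ, v => φ.Holds M v ∨ ψ.Holds M v
  | _, .imp φ ψ, v => φ.Holds M v → ψ.Holds M v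
  | _, .all τ φ, v => ∀ x : M.Obj τ, φ.Holds M (v.cons x)
  | _, .ex τ φ, v => ∃ x : M.Obj τ, φ.Holds M (v.cons x)

/-- A countably saturated nonstandard universe (its internal objects of finite type). Countable
saturation implies that the extension is proper. -/
structure Universe extends Interp.{u} where
  /-- Transfer: a sentence with constants for standard objects is true in the standard
  universe iff its star-version is true in the nonstandard one. -/
  transfer : ∀ φ : Formula [],
    φ.Holds standard (Env.nil standard) ↔ φ.Holds toInterp (Env.nil toInterp)
  /-- Countable saturation: every sequence of internal sets all of whose finite
  subfamilies have a common element has a common element. -/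
  saturated : ∀ (τ : Ty) (A : ℕ → Obj (.set τ)),
    (∀ n : ℕ, ∃ x : Obj τ, ∀ i ≤ n, mem x (A i)) → ∃ x : Obj τ, ∀ i : ℕ, mem x (A i)

namespace Universe

variable (U : Universe.{u})

/-- The graph of a standard function as a standard set of pairs. -/
def stdGraph {σ τ : Ty} (f : σ.Std → τ.Std) : (Ty.set (.prod σ τ)).Std :=
  {p : σ.Std × τ.Std | p.2 = f p.1}

/-- The star-extension of the graph of a function is the graph of a function. -/
theorem exists_app {σ τ : Ty} (f : σ.Std → τ.Std) (x : U.Obj σ) :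
    ∃ y : U.Obj τ, U.mem (U.pair x y) (U.star (stdGraph f)) :=
  (U.transfer (.all σ (.ex τ (.mem (.pair (.var (.succ .zero)) (.var .zero))
    (.const (stdGraph f)))))).1 (fun x => ⟨f x, rfl⟩) x

theorem app_unique {σ τ : Ty} (f : σ.Std → τ.Std) (x : U.Obj σ) (y y' : U.Obj τ)
    (h : U.mem (U.pair x y) (U.star (stdGraph f)))
    (h' : U.mem (U.pair x y') (U.star (stdGraph f))) : y = y' :=
  (U.transfer (.all σ (.all τ (.all τ
    (.imp (.mem (.pair (.var (.succ (.succ .zero))) (.var (.succ .zero))) (.const (stdGraph f)))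
    (.imp (.mem (.pair (.var (.succ (.succ .zero))) (.var .zero)) (.const (stdGraph f)))
      (.eq (.var (.succ .zero)) (.var .zero)))))))).1
    (fun _ _ _ h h' => Eq.trans h (Eq.symm h')) x y y' h h'

/-- The star-extension of a standard function. -/
noncomputable def app {σ τ : Ty} (f : σ.Std → τ.Std) (x : U.Obj σ) : U.Obj τ :=
  (U.exists_app f x).choose

theorem app_spec {σ τ : Ty} (f : σ.Std → τ.Std) (x : U.Obj σ) :
    U.mem (U.pair x (U.app f x)) (U.star (stdGraph f)) :=
  (U.exists_app f x).choose_spec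

/-! ## Hyperintegers and cuts -/

/-- The set of hyperintegers (the star-extension of `ℕ`). -/
abbrev HNat : Type u := U.Obj .nat

/-- Addition of hyperintegers. -/
noncomputable def add (x y : U.HNat) : U.HNat :=
  U.app (σ := .prod .nat .nat) (τ := .nat) (fun p : ℕ × ℕ => p.1 + p.2) (U.pair x y)

/-- The distance `|x - y|` of hyperintegers (natural subtraction truncates, so that one of
the two summands is the distance and the other one is zero). -/
noncomputable def dist (x y : U.HNat) : U.HNat :=
  U.app (σ := .prod .nat .nat) (τ := .nat) (fun p : ℕ × ℕ => (p.1 - p.2) + (p.2 - p.1))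
    (U.pair x y)

/-- The order of hyperintegers. -/
def lt (x y : U.HNat) : Prop :=
  U.mem (U.pair x y) (U.star (τ := .set (.prod .nat .nat)) {p : ℕ × ℕ | p.1 < p.2})

/-- `C` is closed under addition. -/
def IsAdditive (C : Set U.HNat) : Prop :=
  ∀ x ∈ C, ∀ y ∈ C, U.add x y ∈ C

/-- Countably cofinal cuts: unions of intervals `[0, a n)` for strictly increasing `a`. -/
def IsCountablyCofinalCut (C : Set U.HNat) : Prop :=
  ∃ a : ℕ → U.HNat, (∀ n, U.lt (a n) (a (n + 1))) ∧ C = {x | ∃ n, U.lt x (a n)}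

/-- Countably coinitial cuts: intersections of intervals `[0, a n)` for strictly
decreasing `a`. -/
def IsCountablyCoinitialCut (C : Set U.HNat) : Prop :=
  ∃ a : ℕ → U.HNat, (∀ n, U.lt (a (n + 1)) (a n)) ∧ C = {x | ∀ n, U.lt x (a n)}

/-! ## Internal, Borel and countably determined sets -/

/-- Internal subsets of the internal set of all objects of type `τ`. -/
def IsInternal {τ : Ty} (s : Set (U.Obj τ)) : Prop :=
  ∃ A : U.Obj (.set τ), s = {x | U.mem x A}

/-- Borel sets: members of the least sigma-algebra that contains all internal sets. -/
def IsBorel {τ : Ty} (s : Set (U.Obj τ)) : Prop :=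
  @MeasurableSet (U.Obj τ)
    (MeasurableSpace.generateFrom {t : Set (U.Obj τ) | U.IsInternal t}) s

/-- Countably determined sets. -/
def IsCD {τ : Ty} (s : Set (U.Obj τ)) : Prop :=
  ∃ (X : ℕ → Set (U.Obj τ)) (B : Set (Set ℕ)), (∀ m, U.IsInternal (X m)) ∧
    s = ⋃ b ∈ B, ((⋂ m ∈ b, X m) ∩ ⋂ m ∈ bᶜ, ((⋃ n, X n) \ X m))

/-! ## Reducibility -/

/-- A binary relation together with its domain. -/
structure RelOn (τ : Ty) where
  /-- the domain -/
  dom : Set (U.Obj τ)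
  /-- the relation, of interest on the domain only -/
  rel : U.Obj τ → U.Obj τ → Prop

variable {U}

/-- The graph of a map between sets of objects. -/
def graph {σ τ : Ty} {X : Set (U.Obj σ)} {Y : Set (U.Obj τ)} (θ : X → Y) :
    Set (U.Obj (.prod σ τ)) :=
  {z | ∃ x : X, z = U.pair (x : U.Obj σ) (θ x : U.Obj τ)}

/-- `θ` is a reduction of `E` to `F`. -/
def IsReduction {σ τ : Ty} (E : U.RelOn σ) (F : U.RelOn τ) (θ : E.dom → F.dom) : Prop :=
  ∀ x x' : E.dom, E.rel x x' ↔ F.rel (θ x) (θ x')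

/-- Borel reducibility. -/
def BorelLE {σ τ : Ty} (E : U.RelOn σ) (F : U.RelOn τ) : Prop :=
  ∃ θ : E.dom → F.dom, U.IsBorel (graph θ) ∧ IsReduction E F θ

/-- Strict Borel reducibility. -/
def BorelLT {σ τ : Ty} (E : U.RelOn σ) (F : U.RelOn τ) : Prop :=
  BorelLE E F ∧ ¬ BorelLE F E

/-- Countably determined reducibility. -/
def CDLE {σ τ : Ty} (E : U.RelOn σ) (F : U.RelOn τ) : Prop :=
  ∃ θ : E.dom → F.dom, U.IsCD (graph θ) ∧ IsReduction E F θ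

variable (U)

/-- The monadic relation of a cut `C`, on all hyperintegers: `|x - y| ∈ C`. -/
def monadic (C : Set U.HNat) : U.RelOn .nat where
  dom := Set.univ
  rel := fun x y => U.dist x y ∈ C

/-- The internal set of all hyperfinite sets of hyperintegers (the star-extension of the set of
all finite sets of natural numbers). -/
def hyperfinite : Set (U.Obj (.set .nat)) :=
  {A | U.mem A (U.star (τ := .set (.set .nat)) {s : Set ℕ | s.Finite})}

/-- Equality of hyperfinite sets of hyperintegers modulo a finite set: the symmetric
difference is finite (in the external sense). -/
def FD : U.RelOn (.set .nat) where
  dom := U.hyperfinite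
  rel := fun A B => (symmDiff {x : U.HNat | U.mem x A} {x : U.HNat | U.mem x B}).Finite

end Universe

end NSA

/-! Reduction to `FD`. By additivity, a countably cofinal cut has a cofinal sequence of powers `2 ^
v n` with `v` strictly increasing. By saturation the `v n` form an initial segment of a hyperfinite
set `S`. Code `x` by the set of its dyadic levels `level w x` for `w` in `S`. The level at `w`
changes between two points exactly when an odd multiple of `2 ^ w` is crossed. Over a distance below
`2 ^ v` this happens for at most one `w ≥ v`, so points at a distance in the cut have codes that
differ finitely. Equal levels at `w` force a distance below `2 ^ (w + 1)`, so at a distance outside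
the cut the levels differ at every `v n` (`exists_level_ne_imp`, `dist_lt_of_level_eq`,
`borelLE_FD`).

Strictness. A Borel reduction of `FD` to the relation of the cut has a graph with an internal subset
`P` whose domain contains Hamming cubes of every standard size (`IsBorel.exists_internal_subset`).
Saturation makes both directions of the reduction uniform on `P`: sets that differ in fewer than 3
points go to points less than some `a n` apart, and points less than `a n` apart come from sets that
differ in at most `m` points. A cube over a large alphabet forbids this: one-letter steps confine
the images of the constant words to an interval of about `2 * (m + 1)` blocks of length `a n`, and
pigeonhole puts two of them into one block (`false_of_hasCube`). To find `P`, parametrize the Borel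
code of the graph by the Baire space and choose a branch coordinate by coordinate, keeping the
domain dense in a large family. This works because largeness is partition regular, by a Ramsey
theorem for products (`exists_mono_box`, `Large.split`).

Coinitial cuts. A CD graph is a union of atoms of countably many internal sets. Call a finite cell
good if all sufficiently small distances in it are already in the cut. Nested intervals show that
the countably many good cells do not cover (`exists_forall_notMem`), so some point has only bad
cells around it. Saturation then yields two graph points in its atom with first coordinates at a
distance in the cut and second coordinates that differ infinitely (`not_CDLE_FD`). -/

namespace NSA

/-! ## Renaming of variables, transfer with parameters and internal comprehension -/

/-- Renaming under a quantifier. -/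
def liftRen {Γ Δ : List Ty} {σ : Ty} (f : (τ : Ty) → Var Γ τ → Var Δ τ) :
    (τ : Ty) → Var (σ :: Γ) τ → Var (σ :: Δ) τ
  | _, .zero => .zero
  | τ, .succ i => .succ (f τ i)

/-- Renaming of the variables of a term. -/
def Term.rename {Γ Δ : List Ty} (f : (τ : Ty) → Var Γ τ → Var Δ τ) :
    {τ : Ty} → Term Γ τ → Term Δ τ
  | τ, .var i => .var (f τ i)
  | _, .const c => .const c
  | _, .pair s t => .pair (s.rename f) (t.rename f)

/-- Renaming of the variables of a formula. -/
def Formula.rename : {Γ : List Ty} → Formula Γ → {Δ : List Ty} →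
    ((τ : Ty) → Var Γ τ → Var Δ τ) → Formula Δ
  | _, .eq s t, _, f => .eq (s.rename f) (t.rename f)
  | _, .mem s t, _, f => .mem (s.rename f) (t.rename f)
  | _, .neg φ, _, f => .neg (φ.rename f)
  | _, .and φ ψ, _, f => .and (φ.rename f) (ψ.rename f)
  | _, .or φ ψ, _, f => .or (φ.rename f) (ψ.rename f)
  | _, .imp φ ψ, _, f => .imp (φ.rename f) (ψ.rename f)
  | _, .all τ φ, _, f => .all τ (φ.rename (liftRen f))
  | _, .ex τ φ, _, f => .ex τ (φ.rename (liftRen f))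

theorem Term.eval_rename {M : Interp.{u}} {Γ Δ : List Ty} (f : (τ : Ty) → Var Γ τ → Var Δ τ)
    (v : Env M Δ) {τ : Ty} (t : Term Γ τ) :
    (t.rename f).eval v = t.eval (fun τ i => v τ (f τ i)) := by
  induction t with
  | var i => rfl
  | const c => rfl
  | pair s t hs ht => simp only [Term.rename, Term.eval, hs, ht]

theorem Env.cons_liftRen {M : Interp.{u}} {Γ Δ : List Ty} {σ : Ty}
    (f : (τ : Ty) → Var Γ τ → Var Δ τ) (v : Env M Δ) (x : M.Obj σ) :
    (fun τ i => (v.cons x) τ (liftRen f τ i)) = Env.cons x (fun τ i => v τ (f τ i)) := by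
  funext τ i
  cases i <;> rfl

theorem Formula.holds_rename {M : Interp.{u}} {Γ : List Ty} (φ : Formula Γ) :
    ∀ {Δ : List Ty} (f : (τ : Ty) → Var Γ τ → Var Δ τ) (v : Env M Δ),
      (φ.rename f).Holds M v ↔ φ.Holds M (fun τ i => v τ (f τ i)) := by
  induction φ with
  | eq s t => intro Δ f v; simp only [Formula.rename, Formula.Holds, Term.eval_rename]
  | mem s t => intro Δ f v; simp only [Formula.rename, Formula.Holds, Term.eval_rename]
  | neg φ h => intro Δ f v; simp only [Formula.rename, Formula.Holds, h]
  | and φ ψ h h' => intro Δ f v; simp only [Formula.rename, Formula.Holds, h, h']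
  | or φ ψ h h' => intro Δ f v; simp only [Formula.rename, Formula.Holds, h, h']
  | imp φ ψ h h' => intro Δ f v; simp only [Formula.rename, Formula.Holds, h, h']
  | all τ φ h => intro Δ f v; simp only [Formula.rename, Formula.Holds, h, Env.cons_liftRen]
  | ex τ φ h => intro Δ f v; simp only [Formula.rename, Formula.Holds, h, Env.cons_liftRen]

/-- In comprehension the new set is itself a variable lying below the bound element, so `φ` has to
skip a variable that it does not mention. -/
theorem Formula.holds_weaken {M : Interp.{u}} {Γ : List Ty} {σ ρ : Ty} (φ : Formula (σ :: Γ))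
    (v : Env M Γ) (y : M.Obj ρ) (x : M.Obj σ) :
    (φ.rename (liftRen fun _ i => .succ i)).Holds M ((v.cons y).cons x) ↔
      φ.Holds M (v.cons x) := by
  rw [Formula.holds_rename, Env.cons_liftRen]
  rfl

section Variables

variable {Γ : List Ty} {a b c d e f g h i : Ty}

/-- The variable with index 0. -/
abbrev Term.v0 : Term (a :: Γ) a := .var .zero
/-- The variable with index 1. -/
abbrev Term.v1 : Term (a :: b :: Γ) b := .var (.succ .zero)
/-- The variable with index 2. -/
abbrev Term.v2 : Term (a :: b :: c :: Γ) c := .var (.succ (.succ .zero))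
/-- The variable with index 3. -/
abbrev Term.v3 : Term (a :: b :: c :: d :: Γ) d := .var (.succ (.succ (.succ .zero)))
/-- The variable with index 4. -/
abbrev Term.v4 : Term (a :: b :: c :: d :: e :: Γ) e :=
  .var (.succ (.succ (.succ (.succ .zero))))
/-- The variable with index 5. -/
abbrev Term.v5 : Term (a :: b :: c :: d :: e :: f :: Γ) f :=
  .var (.succ (.succ (.succ (.succ (.succ .zero)))))
/-- The variable with index 6. -/
abbrev Term.v6 : Term (a :: b :: c :: d :: e :: f :: g :: Γ) g :=
  .var (.succ (.succ (.succ (.succ (.succ (.succ .zero))))))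
/-- The variable with index 7. -/
abbrev Term.v7 : Term (a :: b :: c :: d :: e :: f :: g :: h :: Γ) h :=
  .var (.succ (.succ (.succ (.succ (.succ (.succ (.succ .zero)))))))
/-- The variable with index 8. -/
abbrev Term.v8 : Term (a :: b :: c :: d :: e :: f :: g :: h :: i :: Γ) i :=
  .var (.succ (.succ (.succ (.succ (.succ (.succ (.succ (.succ .zero))))))))

end Variables

/-- The conjunction of two implications. -/
abbrev Formula.iff {Γ : List Ty} (φ ψ : Formula Γ) : Formula Γ := .and (.imp φ ψ) (.imp ψ φ)

namespace Universe

variable (U : Universe.{u})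

/-- Transfer of the universal closure of a formula. -/
theorem transfer_env : ∀ {Γ : List Ty} (φ : Formula Γ),
    (∀ v : Env standard Γ, φ.Holds standard v) → ∀ v : Env U.toInterp Γ, φ.Holds U.toInterp v
  | [], φ, h, v => by
    have hv : v = Env.nil U.toInterp := by
      funext τ i
      cases i
    rw [hv]
    exact (U.transfer φ).1 (h _)
  | τ :: Γ, φ, h, v => by
    have hv : v = Env.cons (v τ .zero) (fun σ i => v σ (.succ i)) := by
      funext σ i
      cases i <;> rfl
    rw [hv]
    exact transfer_env (.all τ φ) (fun w x => h (w.cons x)) _ _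

/-- Internal comprehension. -/
theorem exists_internal {Γ : List Ty} {σ : Ty} (φ : Formula (σ :: Γ)) (v : Env U.toInterp Γ) :
    ∃ A : U.Obj (.set σ), ∀ x, U.mem x A ↔ φ.Holds U.toInterp (v.cons x) := by
  -- Comprehension is trivially true in the standard universe; the parameters `v` are covered by
  -- transferring its universal closure.
  obtain ⟨A, hA⟩ := U.transfer_env (.ex (.set σ) (.all σ (.iff (.mem .v0 .v1)
    (φ.rename (liftRen fun _ i => .succ i))))) (by
    intro v
    refine ⟨{x : σ.Std | φ.Holds standard (v.cons x)}, fun x => ⟨fun h => ?_, fun h => ?_⟩⟩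
    · exact (Formula.holds_weaken φ v _ x).2 h
    · exact (Formula.holds_weaken φ v _ x).1 h) v
  exact ⟨A, fun x => ⟨fun h => (Formula.holds_weaken φ v A x).1 ((hA x).1 h),
    fun h => (hA x).2 ((Formula.holds_weaken φ v A x).2 h)⟩⟩

variable {U}

theorem exists_eq_pair {σ τ : Ty} (z : U.Obj (.prod σ τ)) : ∃ x y, z = U.pair x y :=
  (U.transfer (.all (.prod σ τ) (.ex σ (.ex τ (.eq .v2 (.pair .v1 .v0)))))).1
    (fun z => ⟨z.1, z.2, rfl⟩) z

theorem pair_inj {σ τ : Ty} {x x' : U.Obj σ} {y y' : U.Obj τ} (h : U.pair x y = U.pair x' y') :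
    x = x' ∧ y = y' :=
  (U.transfer (.all σ (.all σ (.all τ (.all τ (.imp (.eq (.pair .v3 .v1) (.pair .v2 .v0))
    (.and (.eq .v3 .v2) (.eq .v1 .v0)))))))).1
    (fun x x' y y' h => by
      have h' : ((x, y) : σ.Std × τ.Std) = (x', y') := h
      exact Prod.mk.inj h') x x' y y' h

theorem star_mem_star {σ : Ty} {x : σ.Std} {A : Set σ.Std} :
    U.mem (U.star x) (U.star (τ := .set σ) A) ↔ x ∈ A :=
  (U.transfer (.mem (.const x) (.const (τ := .set σ) A))).symm

theorem eq_app_iff {σ τ : Ty} {f : σ.Std → τ.Std} {x : U.Obj σ} {y : U.Obj τ} :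
    y = U.app f x ↔ U.mem (U.pair x y) (U.star (stdGraph f)) :=
  ⟨fun h => h ▸ U.app_spec f x, fun h => U.app_unique f x _ _ h (U.app_spec f x)⟩

/-- Internal comprehension for sets of pairs. -/
theorem exists_internal₂ {Γ : List Ty} {σ τ : Ty} (φ : Formula (σ :: τ :: Γ))
    (v : Env U.toInterp Γ) :
    ∃ A : U.Obj (.set (.prod σ τ)), ∀ x y, U.mem (U.pair x y) A ↔
      φ.Holds U.toInterp ((v.cons y).cons x) := by
  let f : (ρ : Ty) → Var (σ :: τ :: Γ) ρ → Var (σ :: τ :: .prod σ τ :: Γ) ρ :=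
    liftRen (liftRen fun _ i => .succ i)
  obtain ⟨A, hA⟩ := U.exists_internal
    (.ex τ (.ex σ (.and (.eq (.pair .v0 .v1) .v2) (φ.rename f)))) v
  have hf : ∀ (z : U.Obj (.prod σ τ)) y x,
      (φ.rename f).Holds U.toInterp (((v.cons z).cons y).cons x) ↔
        φ.Holds U.toInterp ((v.cons y).cons x) := by
    intro z y x
    rw [Formula.holds_rename, Env.cons_liftRen, Env.cons_liftRen]
    rfl
  refine ⟨A, fun x y => (hA _).trans ⟨?_, fun h => ⟨y, x, rfl, (hf _ _ _).2 h⟩⟩⟩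
  rintro ⟨y', x', he, h⟩
  obtain ⟨hx, hy⟩ := pair_inj (U := U) (x := x') (y := y') (x' := x) (y' := y) he
  subst hx hy
  exact (hf _ _ _).1 h

/-- Countable saturation for pairs of objects. -/
theorem saturated₂ {σ τ : Ty} (A : ℕ → U.Obj (.set (.prod σ τ)))
    (h : ∀ n : ℕ, ∃ x y, ∀ i ≤ n, U.mem (U.pair x y) (A i)) :
    ∃ x y, ∀ i, U.mem (U.pair x y) (A i) := by
  obtain ⟨z, hz⟩ := U.saturated _ A fun n => by
    obtain ⟨x, y, h⟩ := h n
    exact ⟨_, h⟩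
  obtain ⟨x, y, rfl⟩ := exists_eq_pair z
  exact ⟨x, y, hz⟩

/-! ## Order and arithmetic of hyperintegers -/

/-- The standard strict order as a set of pairs. -/
abbrev ltSet : (Ty.set (.prod .nat .nat)).Std := {p : ℕ × ℕ | p.1 < p.2}

theorem lt_trans_aux (x y z : U.HNat) : ¬ U.lt y x → ¬ U.lt z y → ¬ U.lt z x :=
  (U.transfer (.all .nat (.all .nat (.all .nat (.imp
    (.neg (.mem (.pair .v1 .v2) (.const ltSet))) (.imp
    (.neg (.mem (.pair .v0 .v1) (.const ltSet)))
    (.neg (.mem (.pair .v0 .v2) (.const ltSet))))))))).1 (by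
      have h : ∀ x y z : ℕ, ¬ y < x → ¬ z < y → ¬ z < x := by omega
      exact h) x y z

theorem lt_asymm_aux (x y : U.HNat) : U.lt x y → ¬ U.lt y x :=
  (U.transfer (.all .nat (.all .nat (.imp (.mem (.pair .v1 .v0) (.const ltSet))
    (.neg (.mem (.pair .v0 .v1) (.const ltSet))))))).1 (by
      have h : ∀ x y : ℕ, x < y → ¬ y < x := by omega
      exact h) x y

theorem lt_antisymm_aux (x y : U.HNat) : ¬ U.lt y x → ¬ U.lt x y → x = y :=
  (U.transfer (.all .nat (.all .nat (.imp
    (.neg (.mem (.pair .v0 .v1) (.const ltSet))) (.imp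
    (.neg (.mem (.pair .v1 .v0) (.const ltSet))) (.eq .v1 .v0)))))).1 (by
      have h : ∀ x y : ℕ, ¬ y < x → ¬ x < y → x = y := by omega
      exact h) x y

noncomputable instance : LinearOrder U.HNat where
  lt := U.lt
  le x y := ¬ U.lt y x
  le_refl x h := lt_asymm_aux x x h h
  le_trans := lt_trans_aux
  lt_iff_le_not_ge x y := ⟨fun h => ⟨lt_asymm_aux x y h, not_not.2 h⟩, fun h => not_not.1 h.2⟩
  le_antisymm := lt_antisymm_aux
  le_total x y := or_iff_not_imp_left.2 fun h => lt_asymm_aux y x (not_not.1 h)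
  toDecidableLE := Classical.decRel _

/-! ## Finite and infinite internal sets -/

/-- The standard sets of natural numbers with at least `k` elements. -/
abbrev cardGE (k : ℕ) : (Ty.set (.set .nat)).Std := {s : Set ℕ | (k : ℕ∞) ≤ s.encard}

theorem succ_le_encard_iff {α : Type*} {s : Set α} {k : ℕ} :
    ((k + 1 : ℕ) : ℕ∞) ≤ s.encard ↔ ∃ x ∈ s, (k : ℕ∞) ≤ (s \ {x}).encard := by
  constructor
  · intro h
    have hne : s.Nonempty := by
      rw [← Set.one_le_encard_iff_nonempty]
      exact le_trans (by simp) h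
    obtain ⟨x, hx⟩ := hne
    refine ⟨x, hx, ?_⟩
    rw [← Set.encard_sdiff_singleton_add_one hx] at h
    push_cast at h
    exact (ENat.add_le_add_iff_right ENat.one_ne_top).1 h
  · rintro ⟨x, hx, h⟩
    rw [← Set.encard_sdiff_singleton_add_one hx]
    push_cast
    gcongr

/-- For standard `k` the internal and the external count agree, because passing from `k` to `k + 1`
is the removal of one element, which transfers. This lets external finiteness be handled by
saturation. -/
theorem mem_star_cardGE (k : ℕ) : ∀ s : U.Obj (.set .nat),
    U.mem s (U.star (cardGE k)) ↔ (k : ℕ∞) ≤ {x | U.mem x s}.encard := by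
  induction k with
  | zero =>
    intro s
    simp only [Nat.cast_zero, zero_le, iff_true]
    exact (U.transfer (.all (.set .nat) (.mem .v0 (.const (cardGE 0))))).1
      (fun s => by
        have : ((0 : ℕ) : ℕ∞) ≤ (s : Set ℕ).encard := by simp
        exact this) s
  | succ k ih =>
    intro s
    rw [succ_le_encard_iff]
    have key : U.mem s (U.star (cardGE (k + 1))) ↔ ∃ x, U.mem x s ∧ ∃ t,
        (∀ y, (U.mem y t → U.mem y s ∧ y ≠ x) ∧ (U.mem y s ∧ y ≠ x → U.mem y t)) ∧
        U.mem t (U.star (cardGE k)) := by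
      have := (U.transfer (.all (.set .nat) (.iff (.mem .v0 (.const (cardGE (k + 1))))
        (.ex .nat (.and (.mem .v0 .v1) (.ex (.set .nat) (.and (.all .nat (.iff (.mem .v0 .v1)
          (.and (.mem .v0 .v3) (.neg (.eq .v0 .v2))))) (.mem .v0 (.const (cardGE k)))))))))).1
        (by
          have h : ∀ s : Set ℕ, (((k + 1 : ℕ) : ℕ∞) ≤ s.encard → ∃ x, x ∈ s ∧ ∃ t : Set ℕ,
              (∀ y, (y ∈ t → y ∈ s ∧ ¬ y = x) ∧ (y ∈ s ∧ ¬ y = x → y ∈ t)) ∧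
                (k : ℕ∞) ≤ t.encard) ∧ ((∃ x, x ∈ s ∧ ∃ t : Set ℕ,
              (∀ y, (y ∈ t → y ∈ s ∧ ¬ y = x) ∧ (y ∈ s ∧ ¬ y = x → y ∈ t)) ∧
                (k : ℕ∞) ≤ t.encard) → ((k + 1 : ℕ) : ℕ∞) ≤ s.encard) := by
            intro s
            rw [succ_le_encard_iff]
            refine ⟨fun ⟨x, hx, h⟩ => ⟨x, hx, _, fun y => ⟨id, id⟩, h⟩, ?_⟩
            rintro ⟨x, hx, t, ht, h⟩
            refine ⟨x, hx, ?_⟩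
            have : t = s \ {x} := Set.ext fun y => ⟨(ht y).1, (ht y).2⟩
            rwa [← this]
          exact h) s
      exact ⟨this.1, this.2⟩
    rw [key]
    constructor
    · rintro ⟨x, hx, t, ht, h⟩
      refine ⟨x, hx, ?_⟩
      have : {y | U.mem y s} \ {x} = {y | U.mem y t} :=
        Set.ext fun y => ⟨(ht y).2, (ht y).1⟩
      rw [this]
      exact (ih t).1 h
    · rintro ⟨x, hx, h⟩
      obtain ⟨t, ht⟩ := U.exists_internal (Γ := [.nat, .set .nat])
        (.and (.mem .v0 .v2) (.neg (.eq .v0 .v1))) (((Env.nil _).cons s).cons x)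
      refine ⟨x, hx, t, fun y => ⟨(ht y).1, (ht y).2⟩, (ih t).2 ?_⟩
      have : {y | U.mem y s} \ {x} = {y | U.mem y t} :=
        Set.ext fun y => ⟨(ht y).2, (ht y).1⟩
      rwa [← this]

/-- The pairs of standard sets whose symmetric difference has at least `k` elements. -/
abbrev symmDiffGE (k : ℕ) : (Ty.set (.prod (.set .nat) (.set .nat))).Std :=
  {p : Set ℕ × Set ℕ | (k : ℕ∞) ≤ (symmDiff p.1 p.2).encard}

theorem mem_star_symmDiffGE (k : ℕ) (s t : U.Obj (.set .nat)) :
    U.mem (U.pair s t) (U.star (symmDiffGE k)) ↔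
      (k : ℕ∞) ≤ (symmDiff {x | U.mem x s} {x | U.mem x t}).encard := by
  obtain ⟨w, hw⟩ := U.exists_internal (Γ := [.set .nat, .set .nat])
    (.or (.and (.mem .v0 .v1) (.neg (.mem .v0 .v2))) (.and (.mem .v0 .v2) (.neg (.mem .v0 .v1))))
    (((Env.nil _).cons t).cons s)
  have key := (U.transfer (.all (.set .nat) (.all (.set .nat) (.all (.set .nat) (.imp
    (.all .nat (.iff (.mem .v0 .v1) (.or (.and (.mem .v0 .v3) (.neg (.mem .v0 .v2)))
      (.and (.mem .v0 .v2) (.neg (.mem .v0 .v3))))))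
    (.iff (.mem (.pair .v2 .v1) (.const (symmDiffGE k))) (.mem .v0 (.const (cardGE k))))))))).1
    (by
      have h : ∀ s t w : Set ℕ, (∀ x, (x ∈ w → (x ∈ s ∧ ¬ x ∈ t) ∨ (x ∈ t ∧ ¬ x ∈ s)) ∧
          ((x ∈ s ∧ ¬ x ∈ t) ∨ (x ∈ t ∧ ¬ x ∈ s) → x ∈ w)) →
          ((k : ℕ∞) ≤ (symmDiff s t).encard → (k : ℕ∞) ≤ w.encard) ∧
          ((k : ℕ∞) ≤ w.encard → (k : ℕ∞) ≤ (symmDiff s t).encard) := by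
        intro s t w h
        have : w = symmDiff s t := Set.ext fun x => ⟨(h x).1, (h x).2⟩
        rw [this]
        exact ⟨id, id⟩
      exact h) s t w (fun x => ⟨(hw x).1, (hw x).2⟩)
  have hst : symmDiff {x | U.mem x s} {x | U.mem x t} = {x | U.mem x w} :=
    Set.ext fun x => ⟨(hw x).2, (hw x).1⟩
  rw [hst, ← mem_star_cardGE]
  exact ⟨key.1, key.2⟩

theorem finite_iff_exists_not_le_encard {α : Type*} {s : Set α} :
    s.Finite ↔ ∃ k : ℕ, ¬ (k : ℕ∞) ≤ s.encard := by
  rw [← Set.encard_lt_top_iff]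
  constructor
  · intro h
    obtain ⟨n, hn⟩ := ENat.ne_top_iff_exists.1 h.ne
    refine ⟨n + 1, ?_⟩
    rw [← hn]
    exact_mod_cast by omega
  · rintro ⟨k, hk⟩
    exact (not_le.1 hk).trans (ENat.natCast_lt_top k)

/-! ## Reduction of the relation of a countably cofinal cut to equality modulo finite sets -/

/-- The graph of addition. -/
abbrev addGraph : (Ty.set (.prod (.prod .nat .nat) .nat)).Std :=
  stdGraph (σ := .prod .nat .nat) (τ := .nat) fun p : ℕ × ℕ => p.1 + p.2

/-- The graph of the distance function. -/
abbrev distGraph : (Ty.set (.prod (.prod .nat .nat) .nat)).Std :=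
  stdGraph (σ := .prod .nat .nat) (τ := .nat) fun p : ℕ × ℕ => (p.1 - p.2) + (p.2 - p.1)

theorem add_spec (x y : U.HNat) : U.mem (U.pair (U.pair x y) (U.add x y)) (U.star addGraph) :=
  U.app_spec _ _

theorem dist_spec (x y : U.HNat) : U.mem (U.pair (U.pair x y) (U.dist x y)) (U.star distGraph) :=
  U.app_spec _ _

/-- The graph of `n ↦ 2 ^ n`. -/
abbrev powGraph : (Ty.set (.prod .nat .nat)).Std :=
  stdGraph (σ := .nat) (τ := .nat) fun n : ℕ => (2 ^ n : ℕ)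

/-- The power `2 ^ x`. -/
noncomputable def pow (x : U.HNat) : U.HNat :=
  U.app (σ := .nat) (τ := .nat) (fun n : ℕ => (2 ^ n : ℕ)) x

theorem pow_spec (x : U.HNat) : U.mem (U.pair x (pow x)) (U.star powGraph) :=
  U.app_spec _ _

theorem exists_lt_pow {x y : U.HNat} (h : x < y) : ∃ w, x < pow w ∧ pow w ≤ U.add y y := by
  obtain ⟨w, p, hp, h₁, h₂⟩ := (U.transfer (.all .nat (.all .nat (.all .nat
    (.imp (.mem (.pair .v2 .v1) (.const ltSet))
    (.imp (.mem (.pair (.pair .v1 .v1) .v0) (.const addGraph))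
    (.ex .nat (.ex .nat (.and (.mem (.pair .v1 .v0) (.const powGraph))
      (.and (.mem (.pair .v4 .v0) (.const ltSet))
        (.neg (.mem (.pair .v2 .v0) (.const ltSet))))))))))))).1 (by
      have h : ∀ x y s : ℕ, x < y → s = y + y → ∃ w p : ℕ, p = 2 ^ w ∧ x < p ∧ ¬ s < p := by
        rintro x y s h rfl
        -- The exponent is `Nat.size x`, the least one whose power exceeds `x`. The power is at most
        -- `2 * x` for positive `x`; for `x = 0` it is 1, and `y` is positive.
        refine ⟨_, _, rfl, Nat.lt_size_self x, ?_⟩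
        rcases Nat.eq_zero_or_pos x with rfl | hx
        · simp only [Nat.size_zero, pow_zero]
          omega
        · have h₁ : 2 ^ (Nat.size x - 1) ≤ x := Nat.lt_size.1 (by
            have := Nat.size_pos.2 hx
            omega)
          have h₂ : 2 ^ Nat.size x = 2 * 2 ^ (Nat.size x - 1) := by
            rw [← pow_succ', Nat.sub_add_cancel (Nat.size_pos.2 hx)]
          omega
      exact h) x y _ h (add_spec y y)
  obtain rfl : p = pow w := eq_app_iff.2 hp
  exact ⟨w, h₁, h₂⟩

theorem lt_of_pow_lt_pow {x y : U.HNat} (h : pow x < pow y) : x < y :=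
  (U.transfer (.all .nat (.all .nat (.all .nat (.all .nat
    (.imp (.mem (.pair .v3 .v1) (.const powGraph))
    (.imp (.mem (.pair .v2 .v0) (.const powGraph))
    (.imp (.mem (.pair .v1 .v0) (.const ltSet)) (.mem (.pair .v3 .v2) (.const ltSet)))))))))).1 (by
      have h : ∀ x y p q : ℕ, p = 2 ^ x → q = 2 ^ y → p < q → x < y := by
        rintro x y p q rfl rfl h
        exact (Nat.pow_lt_pow_iff_right (by norm_num)).1 h
      exact h) x y _ _ (pow_spec x) (pow_spec y) h

/-! ### Dyadic levels and the code of a hyperinteger -/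

/-- The number of multiples of `2 ^ w` up to `x` that are not multiples of `2 ^ (w + 1)`,
tagged with `w`. -/
def levelFun (p : ℕ × ℕ) : ℕ := Nat.pair p.1 ((p.2 + 2 ^ p.1) / 2 ^ (p.1 + 1))

/-- The graph of `levelFun`. -/
abbrev levelGraph : (Ty.set (.prod (.prod .nat .nat) .nat)).Std :=
  stdGraph (σ := .prod .nat .nat) (τ := .nat) levelFun

/-- The star-extension of `levelFun`. -/
noncomputable def level (w x : U.HNat) : U.HNat :=
  U.app (σ := .prod .nat .nat) (τ := .nat) levelFun (U.pair w x)

theorem level_spec (w x : U.HNat) :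
    U.mem (U.pair (U.pair w x) (level w x)) (U.star levelGraph) :=
  U.app_spec _ _

/-- A shift by `2 ^ w` turns odd multiples of `2 ^ w` into multiples of `2 ^ (w + 1)`, so the
quotient jumps only when an odd multiple is crossed. -/
theorem exists_odd_mul_of_div_ne {x y w : ℕ} (hxy : x ≤ y)
    (h : (x + 2 ^ w) / 2 ^ (w + 1) ≠ (y + 2 ^ w) / 2 ^ (w + 1)) :
    ∃ k, x < (2 * k + 1) * 2 ^ w ∧ (2 * k + 1) * 2 ^ w ≤ y := by
  have hp : 0 < 2 ^ w := by positivity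
  have hlt : (x + 2 ^ w) / 2 ^ (w + 1) < (y + 2 ^ w) / 2 ^ (w + 1) :=
    lt_of_le_of_ne (Nat.div_le_div_right (by omega)) h
  obtain ⟨k, hk⟩ : ∃ k, (y + 2 ^ w) / 2 ^ (w + 1) = k + 1 :=
    Nat.exists_eq_succ_of_ne_zero (Nat.ne_of_gt (lt_of_le_of_lt (Nat.zero_le _) hlt))
  rw [hk, Nat.div_lt_iff_lt_mul (by positivity)] at hlt
  have h₂ : (k + 1) * 2 ^ (w + 1) ≤ y + 2 ^ w := by
    rw [← hk]
    exact Nat.div_mul_le_self _ _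
  refine ⟨k, ?_, ?_⟩ <;> rw [pow_succ] at * <;> nlinarith

/-- Both numbers are multiples of `2 ^ v` in an interval shorter than `2 ^ v`, hence equal; but
their 2-adic valuations differ. -/
theorem odd_mul_pow_eq {v w w' k k' x y : ℕ} (hvw : v ≤ w) (hww : w < w') (hxy : y < x + 2 ^ v)
    (h₁ : x < (2 * k + 1) * 2 ^ w) (h₂ : (2 * k + 1) * 2 ^ w ≤ y)
    (h₃ : x < (2 * k' + 1) * 2 ^ w') (h₄ : (2 * k' + 1) * 2 ^ w' ≤ y) : False := by
  obtain ⟨c, rfl⟩ := Nat.exists_eq_add_of_le hvw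
  obtain ⟨d, rfl⟩ := Nat.exists_eq_add_of_lt hww
  have e₁ : (2 * k + 1) * 2 ^ (v + c) = ((2 * k + 1) * 2 ^ c) * 2 ^ v := by ring
  have e₂ : (2 * k' + 1) * 2 ^ (v + c + d + 1) = ((2 * k' + 1) * 2 ^ (d + 1) * 2 ^ c) * 2 ^ v := by
    ring
  rw [e₁] at h₁ h₂
  rw [e₂] at h₃ h₄
  have hp : 0 < 2 ^ v := by positivity
  have e : (2 * k + 1) * 2 ^ c = (2 * k' + 1) * 2 ^ (d + 1) * 2 ^ c := by
    rcases lt_trichotomy ((2 * k + 1) * 2 ^ c) ((2 * k' + 1) * 2 ^ (d + 1) * 2 ^ c) with h | h | h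
    · nlinarith
    · exact h
    · nlinarith
  have e' := Nat.eq_of_mul_eq_mul_right (by positivity) e
  rw [pow_succ] at e'
  have : 2 * k + 1 = 2 * ((2 * k' + 1) * 2 ^ d) := by linarith
  omega

/-- Two exponents at or above `v` with changed levels would give two odd multiples that contradict
`odd_mul_pow_eq`. -/
theorem exists_level_ne_imp {v x y : ℕ} (hxy : (x - y) + (y - x) < 2 ^ v) :
    ∃ v₁, ∀ w, levelFun (w, x) ≠ levelFun (w, y) → w < v ∨ w = v₁ := by
  wlog h : x ≤ y generalizing x y
  · obtain ⟨v₁, h₁⟩ := this (x := y) (y := x) (by omega) (by omega)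
    exact ⟨v₁, fun w hw => h₁ w hw.symm⟩
  by_cases hex : ∃ w, v ≤ w ∧ levelFun (w, x) ≠ levelFun (w, y)
  · obtain ⟨v₁, hv₁, hne⟩ := hex
    refine ⟨v₁, fun w hw => ?_⟩
    by_contra! hcon
    have key : ∀ {w}, levelFun (w, x) ≠ levelFun (w, y) →
        (x + 2 ^ w) / 2 ^ (w + 1) ≠ (y + 2 ^ w) / 2 ^ (w + 1) := by
      intro w hw he
      exact hw (by simp only [levelFun, he])
    obtain ⟨k, h₁, h₂⟩ := exists_odd_mul_of_div_ne h (key hne)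
    obtain ⟨k', h₃, h₄⟩ := exists_odd_mul_of_div_ne h (key hw)
    rcases lt_or_gt_of_ne hcon.2 with hlt | hlt
    · exact odd_mul_pow_eq hcon.1 hlt (by omega) h₃ h₄ h₁ h₂
    · exact odd_mul_pow_eq hv₁ hlt (by omega) h₁ h₂ h₃ h₄
  · push Not at hex
    refine ⟨0, fun w hw => Or.inl ?_⟩
    by_contra! hcon
    exact hw (hex w hcon)

theorem dist_lt_of_level_eq {w w' x y : ℕ} (h : levelFun (w, x) = levelFun (w', y)) :
    w = w' ∧ (x - y) + (y - x) < 2 ^ w + 2 ^ w := by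
  obtain ⟨rfl, h⟩ := Nat.pair_eq_pair.1 h
  refine ⟨rfl, ?_⟩
  dsimp only at h
  have hx := Nat.div_add_mod (x + 2 ^ w) (2 ^ (w + 1))
  have hy := Nat.div_add_mod (y + 2 ^ w) (2 ^ (w + 1))
  have hx' := Nat.mod_lt (x + 2 ^ w) (show 2 ^ (w + 1) > 0 by positivity)
  have hy' := Nat.mod_lt (y + 2 ^ w) (show 2 ^ (w + 1) > 0 by positivity)
  rw [← h] at hy
  have hp : 2 ^ (w + 1) = 2 ^ w + 2 ^ w := by ring
  omega

theorem exists_level_ne_imp_star {v x y : U.HNat} (hxy : U.dist x y < pow v) :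
    ∃ v₁, ∀ w, level w x ≠ level w y → w < v ∨ w = v₁ := by
  obtain ⟨v₁, h⟩ := (U.transfer (.all .nat (.all .nat (.all .nat (.all .nat (.all .nat
    (.imp (.mem (.pair (.pair .v4 .v3) .v1) (.const distGraph))
    (.imp (.mem (.pair .v2 .v0) (.const powGraph))
    (.imp (.mem (.pair .v1 .v0) (.const ltSet))
    (.ex .nat (.all .nat (.all .nat (.all .nat
    (.imp (.mem (.pair (.pair .v2 .v8) .v1) (.const levelGraph))
    (.imp (.mem (.pair (.pair .v2 .v7) .v0) (.const levelGraph))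
    (.imp (.neg (.eq .v1 .v0))
    (.or (.mem (.pair .v2 .v6) (.const ltSet)) (.eq .v2 .v3)))))))))))))))))).1 (by
      have h : ∀ x y v d p : ℕ, d = (x - y) + (y - x) → p = 2 ^ v → d < p →
          ∃ v₁, ∀ w a b : ℕ, a = levelFun (w, x) → b = levelFun (w, y) → ¬ a = b →
            w < v ∨ w = v₁ := by
        rintro x y v d p rfl rfl h
        obtain ⟨v₁, h₁⟩ := exists_level_ne_imp h
        refine ⟨v₁, ?_⟩
        rintro w a b rfl rfl h
        exact h₁ w h
      exact h) x y v _ _ (dist_spec x y) (pow_spec v) hxy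
  exact ⟨v₁, fun w hw => h w _ _ (level_spec w x) (level_spec w y) hw⟩

theorem dist_lt_of_level_eq_star {w w' x y : U.HNat} (h : level w x = level w' y) :
    w = w' ∧ U.dist x y < U.add (pow w) (pow w) := by
  have h' := level_spec w' y
  rw [← h] at h'
  exact (U.transfer (.all .nat (.all .nat (.all .nat (.all .nat (.all .nat (.all .nat (.all .nat
    (.all .nat
    (.imp (.mem (.pair (.pair .v5 .v7) .v3) (.const levelGraph))
    (.imp (.mem (.pair (.pair .v4 .v6) .v3) (.const levelGraph))
    (.imp (.mem (.pair (.pair .v7 .v6) .v2) (.const distGraph))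
    (.imp (.mem (.pair .v5 .v1) (.const powGraph))
    (.imp (.mem (.pair (.pair .v1 .v1) .v0) (.const addGraph))
    (.and (.eq .v5 .v4) (.mem (.pair .v2 .v0) (.const ltSet))))))))))))))))).1 (by
      have h : ∀ x y w w' a d p s : ℕ, a = levelFun (w, x) → a = levelFun (w', y) →
          d = (x - y) + (y - x) → p = 2 ^ w → s = p + p → w = w' ∧ d < s := by
        rintro x y w w' a d p s rfl h rfl rfl rfl
        exact dist_lt_of_level_eq h
      exact h) x y w w' _ _ _ _ (level_spec w x) h' (dist_spec x y)
    (pow_spec w) (add_spec (pow w) (pow w))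

/-- The set of all values `levelFun (w, x)` for `w` in a given set. -/
def codeFun (p : Set ℕ × ℕ) : Set ℕ := {z | ∃ w, w ∈ p.1 ∧ z = levelFun (w, p.2)}

/-- The graph of `codeFun`. -/
abbrev codeGraph : (Ty.set (.prod (.prod (.set .nat) .nat) (.set .nat))).Std :=
  stdGraph (σ := .prod (.set .nat) .nat) (τ := .set .nat) codeFun

/-- The star-extension of `codeFun`. -/
noncomputable def code (S : U.Obj (.set .nat)) (x : U.HNat) : U.Obj (.set .nat) :=
  U.app (σ := .prod (.set .nat) .nat) (τ := .set .nat) codeFun (U.pair S x)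

theorem code_spec (S : U.Obj (.set .nat)) (x : U.HNat) :
    U.mem (U.pair (U.pair S x) (code S x)) (U.star codeGraph) :=
  U.app_spec _ _

/-- The set of finite sets of natural numbers. -/
abbrev finSets : (Ty.set (.set .nat)).Std := {s : Set ℕ | s.Finite}

theorem mem_code {S : U.Obj (.set .nat)} {x z : U.HNat} :
    U.mem z (code S x) ↔ ∃ w, U.mem w S ∧ z = level w x := by
  have key := (U.transfer (.all (.set .nat) (.all .nat (.all (.set .nat)
    (.imp (.mem (.pair (.pair .v2 .v1) .v0) (.const codeGraph))
    (.all .nat (.iff (.mem .v0 .v1) (.ex .nat (.and (.mem .v0 .v4)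
      (.mem (.pair (.pair .v0 .v3) .v1) (.const levelGraph))))))))))).1 (by
      have h : ∀ (S : Set ℕ) (x : ℕ) (T : Set ℕ), T = codeFun (S, x) → ∀ z,
          (z ∈ T → ∃ w, w ∈ S ∧ z = levelFun (w, x)) ∧
          ((∃ w, w ∈ S ∧ z = levelFun (w, x)) → z ∈ T) := by
        rintro S x T rfl z
        exact ⟨id, id⟩
      exact h) S x _ (code_spec S x) z
  refine ⟨fun h => ?_, ?_⟩
  · obtain ⟨w, hw, hz⟩ := key.1 h
    exact ⟨w, hw, eq_app_iff.2 hz⟩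
  · rintro ⟨w, hw, rfl⟩
    exact key.2 ⟨w, hw, level_spec w x⟩

theorem code_mem_hyperfinite {S : U.Obj (.set .nat)} (hS : S ∈ U.hyperfinite) (x : U.HNat) :
    code S x ∈ U.hyperfinite :=
  (U.transfer (.all (.set .nat) (.all .nat (.all (.set .nat)
    (.imp (.mem .v2 (.const finSets))
    (.imp (.mem (.pair (.pair .v2 .v1) .v0) (.const codeGraph))
    (.mem .v0 (.const finSets)))))))).1 (by
      have h : ∀ (S : Set ℕ) (x : ℕ) (T : Set ℕ), S.Finite → T = codeFun (S, x) → T.Finite := by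
        rintro S x T hS rfl
        refine (hS.image fun w => levelFun (w, x)).subset ?_
        rintro z ⟨w, hw, rfl⟩
        exact ⟨w, hw, rfl⟩
      exact h) S x _ hS (code_spec S x)

theorem isInternal_graph_code (S : U.Obj (.set .nat)) :
    U.IsInternal {z | ∃ x : U.HNat, z = U.pair x (code S x)} := by
  obtain ⟨A, hA⟩ := U.exists_internal (σ := .prod .nat (.set .nat)) (Γ := [.set .nat])
    (.ex .nat (.ex (.set .nat) (.and (.eq .v2 (.pair .v1 .v0))
      (.mem (.pair (.pair .v3 .v1) .v0) (.const codeGraph))))) ((Env.nil _).cons S)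
  refine ⟨A, Set.ext fun z => Iff.trans ⟨?_, ?_⟩ (hA z).symm⟩
  · rintro ⟨x, rfl⟩
    exact ⟨x, _, rfl, code_spec S x⟩
  · rintro ⟨x, T, hz, hT⟩
    obtain rfl : T = code S x := eq_app_iff.2 hT
    exact ⟨x, hz⟩

theorem exists_insert (F : U.Obj (.set .nat)) (x : U.HNat) :
    ∃ G : U.Obj (.set .nat), (F ∈ U.hyperfinite → G ∈ U.hyperfinite) ∧
      ∀ w, U.mem w G ↔ U.mem w F ∨ w = x := by
  obtain ⟨G, h, hG⟩ := (U.transfer (.all (.set .nat) (.all .nat (.ex (.set .nat) (.and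
    (.imp (.mem .v2 (.const finSets)) (.mem .v0 (.const finSets)))
    (.all .nat (.iff (.mem .v0 .v1) (.or (.mem .v0 .v3) (.eq .v0 .v2))))))))).1 (by
      have h : ∀ (F : Set ℕ) (x : ℕ), ∃ G : Set ℕ, (F.Finite → G.Finite) ∧
          ∀ w, (w ∈ G → w ∈ F ∨ w = x) ∧ (w ∈ F ∨ w = x → w ∈ G) :=
        fun F x => ⟨insert x F, fun h => h.insert x, fun w =>
          ⟨fun h => (Set.mem_insert_iff.1 h).symm, fun h => Set.mem_insert_iff.2 h.symm⟩⟩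
      exact h) F x
  exact ⟨G, h, fun w => ⟨(hG w).1, (hG w).2⟩⟩

theorem exists_hyperfinite_range (v : ℕ → U.HNat) (n : ℕ) :
    ∃ F ∈ U.hyperfinite, ∀ w, U.mem w F ↔ ∃ j < n, w = v j := by
  induction n with
  | zero =>
    refine ⟨U.star (τ := .set .nat) (∅ : Set ℕ), ?_, fun w => ?_⟩
    · exact star_mem_star (U := U) (σ := .set .nat) (A := finSets).2 Set.finite_empty
    · have := (U.transfer (.all .nat (.neg (.mem .v0 (.const (τ := .set .nat) (∅ : Set ℕ)))))).1
        (fun x => Set.notMem_empty (x : ℕ)) w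
      simp only [not_lt_zero, false_and, exists_false, iff_false]
      exact this
  | succ n ih =>
    obtain ⟨F, hF, h⟩ := ih
    obtain ⟨G, hG, hG'⟩ := exists_insert F (v n)
    refine ⟨G, hG hF, fun w => ?_⟩
    rw [hG', h]
    constructor
    · rintro (⟨j, hj, rfl⟩ | rfl)
      · exact ⟨j, by omega, rfl⟩
      · exact ⟨n, by omega, rfl⟩
    · rintro ⟨j, hj, rfl⟩
      rcases Nat.lt_succ_iff_lt_or_eq.1 hj with hj | rfl
      · exact Or.inl ⟨j, hj, rfl⟩
      · exact Or.inr rfl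

/-- An increasing sequence is an initial segment of a hyperfinite set. -/
theorem exists_hyperfinite_extension {v : ℕ → U.HNat} (hv : StrictMono v) :
    ∃ S ∈ U.hyperfinite, (∀ i, U.mem (v i) S) ∧
      ∀ i w, U.mem w S → w < v i → ∃ j < i, w = v j := by
  choose F hF hF' using exists_hyperfinite_range v
  -- Condition `i` on a set: it is hyperfinite, contains `v i`, and below `v i` has only elements of
  -- `F i`. The set `F (n + 1)` meets the conditions up to `n`.
  choose A hA using fun i => U.exists_internal (σ := .set .nat) (Γ := [.set .nat, .nat])
    (.and (.mem .v0 (.const finSets)) (.and (.mem .v2 .v0) (.all .nat (.imp (.mem .v0 .v1)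
      (.imp (.mem (.pair .v0 .v3) (.const ltSet)) (.mem .v0 .v2))))))
    (((Env.nil _).cons (v i)).cons (F i))
  obtain ⟨S, hS⟩ := U.saturated _ A fun n => by
    refine ⟨F (n + 1), fun i hi => (hA i _).2 ⟨hF _, (hF' _ _).2 ⟨i, by omega, rfl⟩, ?_⟩⟩
    intro w hw hlt
    obtain ⟨j, -, rfl⟩ := (hF' _ _).1 hw
    exact (hF' _ _).2 ⟨j, hv.lt_iff_lt.1 hlt, rfl⟩
  exact ⟨S, ((hA 0 S).1 (hS 0)).1, fun i => ((hA i S).1 (hS i)).2.1,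
    fun i w hw hlt => (hF' _ _).1 (((hA i S).1 (hS i)).2.2 w hw hlt)⟩

theorem IsCountablyCofinalCut.mem_of_le {C : Set U.HNat} (hC : U.IsCountablyCofinalCut C)
    {x y : U.HNat} (hxy : x ≤ y) (hy : y ∈ C) : x ∈ C := by
  obtain ⟨a, -, rfl⟩ := hC
  obtain ⟨n, hn⟩ := hy
  exact ⟨n, lt_of_le_of_lt (a := x) hxy hn⟩

/-- Powers of two with increasing exponents are cofinal in an additive countably cofinal cut. -/
theorem exists_cofinal_pow {C : Set U.HNat} (hadd : U.IsAdditive C)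
    (hC : U.IsCountablyCofinalCut C) :
    ∃ v : ℕ → U.HNat, StrictMono v ∧ (∀ n, pow (v n) ∈ C) ∧ ∀ x ∈ C, ∃ n, x < pow (v n) := by
  have hC' := hC
  obtain ⟨a, ha, hCa⟩ := hC
  have ha' : StrictMono a := strictMono_nat_of_lt_succ ha
  have hmem : ∀ n, a n ∈ C := fun n => hCa ▸ ⟨n + 1, ha n⟩
  have step : ∀ n, ∃ w, a n < pow w ∧ pow w ∈ C := fun n => by
    obtain ⟨w, h, h'⟩ := exists_lt_pow (ha' (Nat.lt_succ_self n))
    exact ⟨w, h, hC'.mem_of_le h' (hadd _ (hmem _) _ (hmem _))⟩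
  have next : ∀ (n : ℕ) (p : {w : U.HNat // pow w ∈ C}),
      ∃ q : {w : U.HNat // pow w ∈ C}, p.1 < q.1 ∧ a n < pow q.1 := by
    rintro n ⟨w, hw⟩
    obtain ⟨m, hm⟩ : ∃ m, pow w < a m := by
      rw [hCa] at hw
      exact hw
    -- Index `m` makes the exponents increase; index `n` makes the powers cofinal.
    obtain ⟨w', h, h'⟩ := step (max m n)
    refine ⟨⟨w', h'⟩, lt_of_pow_lt_pow ?_, ?_⟩
    · exact lt_of_lt_of_le hm ((ha'.monotone (le_max_left m n)).trans h.le)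
    · exact lt_of_le_of_lt (ha'.monotone (le_max_right m n)) h
  choose f hf hf' using next
  obtain ⟨w₀, -, hw₀⟩ := step 0
  let v : ℕ → {w : U.HNat // pow w ∈ C} := fun n => Nat.rec ⟨w₀, hw₀⟩ (fun n p => f n p) n
  refine ⟨fun n => (v n).1, strictMono_nat_of_lt_succ fun n => hf n (v n), fun n => (v n).2, ?_⟩
  intro x hx
  obtain ⟨n, hn⟩ : ∃ m, x < a m := by
    rw [hCa] at hx
    exact hx
  exact ⟨n + 1, hn.trans (hf' n (v n))⟩

/-- The coding map is internal, so its graph is trivially Borel; all the content lies in comparing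
the levels. -/
theorem borelLE_FD {C : Set U.HNat} (hadd : U.IsAdditive C) (hC : U.IsCountablyCofinalCut C) :
    BorelLE (U.monadic C) U.FD := by
  obtain ⟨v, hv, hvC, hcof⟩ := exists_cofinal_pow hadd hC
  obtain ⟨S, hS, hvS, hSv⟩ := exists_hyperfinite_extension hv
  refine ⟨fun x => ⟨code S x.1, code_mem_hyperfinite hS x.1⟩, ?_, ?_⟩
  · refine MeasurableSpace.measurableSet_generateFrom ?_
    obtain ⟨A, hA⟩ := isInternal_graph_code S
    refine ⟨A, hA ▸ Set.ext fun z => ?_⟩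
    exact ⟨fun ⟨x, hx⟩ => ⟨x.1, hx⟩, fun ⟨x, hx⟩ => ⟨⟨x, trivial⟩, hx⟩⟩
  · rintro ⟨x, -⟩ ⟨y, -⟩
    change U.dist x y ∈ C ↔ (symmDiff {z | U.mem z (code S x)} {z | U.mem z (code S y)}).Finite
    constructor
    · intro h
      obtain ⟨n, hn⟩ := hcof _ h
      obtain ⟨v₁, hv₁⟩ := exists_level_ne_imp_star hn
      -- Below `v n` the set `S` has only the finitely many earlier terms; `v₁` is the one possible
      -- exception above.
      have hfin : (v '' Set.Iio n ∪ {v₁}).Finite :=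
        ((Set.finite_Iio n).image v).union (Set.finite_singleton v₁)
      have hin : ∀ w, U.mem w S → level w x ≠ level w y → w ∈ v '' Set.Iio n ∪ {v₁} := by
        intro w hw hne
        rcases hv₁ w hne with hlt | rfl
        · obtain ⟨j, hj, rfl⟩ := hSv n w hw hlt
          exact Or.inl ⟨j, hj, rfl⟩
        · exact Or.inr rfl
      refine ((hfin.image fun w => level w x).union (hfin.image fun w => level w y)).subset ?_
      rintro z (⟨h₁, h₂⟩ | ⟨h₁, h₂⟩)
      · obtain ⟨w, hw, rfl⟩ := mem_code.1 h₁
        exact Or.inl ⟨w, hin w hw fun he => h₂ (mem_code.2 ⟨w, hw, he⟩), rfl⟩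
      · obtain ⟨w, hw, rfl⟩ := mem_code.1 h₁
        exact Or.inr ⟨w, hin w hw fun he => h₂ (mem_code.2 ⟨w, hw, he.symm⟩), rfl⟩
    · intro hfin
      by_contra hxy
      -- The levels of `x` at all `v n` are distinct by their tags, and none of them is in the code
      -- of `y`.
      refine Set.infinite_range_of_injective (f := fun n => level (v n) x) ?_ (hfin.subset ?_)
      · intro m n h
        exact hv.injective (dist_lt_of_level_eq_star h).1
      · rintro _ ⟨n, rfl⟩
        refine Or.inl ⟨mem_code.2 ⟨_, hvS n, rfl⟩, fun h => hxy ?_⟩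
        obtain ⟨w, -, hw⟩ := mem_code.1 h
        exact hC.mem_of_le (dist_lt_of_level_eq_star hw).2.le (hadd _ (hvC n) _ (hvC n))

/-! ## Countably coinitial cuts -/

theorem IsCountablyCoinitialCut.mem_of_le {C : Set U.HNat} (hC : U.IsCountablyCoinitialCut C)
    {x y : U.HNat} (hxy : x ≤ y) (hy : y ∈ C) : x ∈ C := by
  obtain ⟨a, -, rfl⟩ := hC
  exact fun n => lt_of_le_of_lt (a := x) hxy (hy n)

theorem add_le_add_left' {p l m : U.HNat} (h : m ≤ l) : U.add p m ≤ U.add p l :=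
  (U.transfer (.all .nat (.all .nat (.all .nat (.all .nat (.all .nat
    (.imp (.mem (.pair (.pair .v4 .v3) .v1) (.const addGraph))
    (.imp (.mem (.pair (.pair .v4 .v2) .v0) (.const addGraph))
    (.imp (.neg (.mem (.pair .v3 .v2) (.const ltSet)))
      (.neg (.mem (.pair .v1 .v0) (.const ltSet)))))))))))).1 (by
      have h : ∀ p l m e e' : ℕ, e = p + l → e' = p + m → ¬ l < m → ¬ e < e' := by omega
      exact h) p l m _ _ (add_spec p l) (add_spec p m) h

theorem dist_lt_of_mem_interval {p l x y : U.HNat} (hx : p ≤ x) (hx' : x < U.add p l)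
    (hy : p ≤ y) (hy' : y < U.add p l) : U.dist x y < l :=
  (U.transfer (.all .nat (.all .nat (.all .nat (.all .nat (.all .nat (.all .nat
    (.imp (.mem (.pair (.pair .v5 .v4) .v1) (.const addGraph))
    (.imp (.mem (.pair (.pair .v3 .v2) .v0) (.const distGraph))
    (.imp (.neg (.mem (.pair .v3 .v5) (.const ltSet)))
    (.imp (.mem (.pair .v3 .v1) (.const ltSet))
    (.imp (.neg (.mem (.pair .v2 .v5) (.const ltSet)))
    (.imp (.mem (.pair .v2 .v1) (.const ltSet))
      (.mem (.pair .v0 .v4) (.const ltSet))))))))))))))).1 (by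
      have h : ∀ p l x y e d : ℕ, e = p + l → d = (x - y) + (y - x) → ¬ x < p → x < e →
        ¬ y < p → y < e → d < l := by omega
      exact h) p l x y _ _ (add_spec p l) (dist_spec x y) hx hx' hy hy'

theorem lt_add_of_lt {p l z : U.HNat} (h : z < l) : p < U.add p l :=
  (U.transfer (.all .nat (.all .nat (.all .nat (.all .nat
    (.imp (.mem (.pair (.pair .v3 .v2) .v0) (.const addGraph))
    (.imp (.mem (.pair .v1 .v2) (.const ltSet))
      (.mem (.pair .v3 .v0) (.const ltSet))))))))).1 (by
      have h : ∀ p l z e : ℕ, e = p + l → z < l → p < e := by omega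
      exact h) p l z _ (add_spec p l) h

theorem one_lt_of_lt_of_lt {x y z : U.HNat} (h : z < y) (h' : y < x) :
    U.star (τ := .nat) (1 : ℕ) < x :=
  (U.transfer (.all .nat (.all .nat (.all .nat
    (.imp (.mem (.pair .v0 .v1) (.const ltSet))
    (.imp (.mem (.pair .v1 .v2) (.const ltSet))
      (.mem (.pair (.const (τ := .nat) (1 : ℕ)) .v2) (.const ltSet)))))))).1 (by
      have h : ∀ x y z : ℕ, z < y → y < x → 1 < x := by omega
      exact h) x y z h h'

/-- The pairs `(l, h)` with `l < 4 * h + 4`. -/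
abbrev quarterSet : (Ty.set (.prod .nat .nat)).Std := {p : ℕ × ℕ | p.1 < 4 * p.2 + 4}

theorem lt_of_mem_quarterSet {l h q : U.HNat}
    (hlh : U.mem (U.pair l h) (U.star quarterSet)) (hq : q = U.add h (U.star (τ := .nat) (1 : ℕ))) :
    l < U.add (U.add q q) (U.add q q) := by
  have h₁ := add_spec h (U.star (τ := .nat) (1 : ℕ))
  rw [← hq] at h₁
  exact (U.transfer (.all .nat (.all .nat (.all .nat (.all .nat (.all .nat
    (.imp (.mem (.pair .v4 .v3) (.const quarterSet))
    (.imp (.mem (.pair (.pair .v3 (.const (τ := .nat) (1 : ℕ))) .v2) (.const addGraph))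
    (.imp (.mem (.pair (.pair .v2 .v2) .v1) (.const addGraph))
    (.imp (.mem (.pair (.pair .v1 .v1) .v0) (.const addGraph))
      (.mem (.pair .v4 .v0) (.const ltSet)))))))))))).1 (by
      have h : ∀ l h q s r : ℕ, l < 4 * h + 4 → q = h + 1 → s = q + q → r = s + s → l < r := by
        omega
      exact h) l h q _ _ hlh h₁ (add_spec q q) (add_spec _ _)

/-- A quarter of an interval lies away from a given point. -/
theorem exists_quarter {p l x : U.HNat} (hx : p ≤ x) (hx' : x < U.add p l) :
    ∃ p' h, U.mem (U.pair l h) (U.star quarterSet) ∧ ∀ y, p' ≤ y → y < U.add p' h →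
      p ≤ y ∧ y < U.add p l ∧ h ≤ U.dist x y := by
  obtain ⟨p', h, e', he', hlh, H⟩ := (U.transfer (.all .nat (.all .nat (.all .nat (.all .nat
    (.imp (.mem (.pair (.pair .v3 .v2) .v0) (.const addGraph))
    (.imp (.neg (.mem (.pair .v1 .v3) (.const ltSet)))
    (.imp (.mem (.pair .v1 .v0) (.const ltSet))
    (.ex .nat (.ex .nat (.ex .nat (.and (.mem (.pair (.pair .v2 .v1) .v0) (.const addGraph))
    (.and (.mem (.pair .v5 .v1) (.const quarterSet))
    (.all .nat (.all .nat (.imp (.mem (.pair (.pair .v6 .v1) .v0) (.const distGraph))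
    (.imp (.neg (.mem (.pair .v1 .v4) (.const ltSet)))
    (.imp (.mem (.pair .v1 .v2) (.const ltSet))
    (.and (.neg (.mem (.pair .v1 .v8) (.const ltSet)))
    (.and (.mem (.pair .v1 .v5) (.const ltSet))
      (.neg (.mem (.pair .v0 .v3) (.const ltSet))))))))))))))))))))))).1 (by
      have h : ∀ p l x e : ℕ, e = p + l → ¬ x < p → x < e → ∃ p' h e' : ℕ, e' = p' + h ∧
          l < 4 * h + 4 ∧ ∀ y d : ℕ, d = (x - y) + (y - x) → ¬ y < p' → y < e' →
            ¬ y < p ∧ y < e ∧ ¬ d < h := by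
        rintro p l x e rfl h₁ h₂
        -- A point in the lower half is avoided by the last quarter, any other one by the first.
        -- Rounding in `l / 4` causes the slack `+ 4` in `quarterSet`.
        rcases lt_or_ge x (p + 2 * (l / 4)) with hlt | hge
        · exact ⟨p + 3 * (l / 4), l / 4, _, rfl, by omega, by omega⟩
        · exact ⟨p, l / 4, _, rfl, by omega, by omega⟩
      exact h) p l x _ (add_spec p l) hx hx'
  obtain rfl : e' = U.add p' h := eq_app_iff.2 he'
  exact ⟨p', h, hlh, fun y h₁ h₂ => H y _ (dist_spec x y) h₁ h₂⟩

/-- An interval of length outside the cut contains such an interval that avoids a given set in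
which all small distances are in the cut. -/
theorem exists_subinterval {C : Set U.HNat} (hadd : U.IsAdditive C) {a : ℕ → U.HNat}
    (ha : StrictAnti a) (hC : C = {x | ∀ n, x < a n}) {W : Set U.HNat}
    (hW : ∃ n, ∀ x ∈ W, ∀ y ∈ W, U.dist x y < a n → U.dist x y ∈ C) (p : U.HNat) {l : U.HNat}
    (hl : l ∉ C) :
    ∃ p' l', l' ∉ C ∧ ∀ y, p' ≤ y → y < U.add p' l' → p ≤ y ∧ y < U.add p l ∧ y ∉ W := by
  have hcut : U.IsCountablyCoinitialCut C := ⟨a, fun n => ha (Nat.lt_succ_self n), hC⟩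
  obtain ⟨n, hn⟩ := hW
  -- In an interval of this length all distances are below `a n`, so the hypothesis on `W` applies
  -- to any two of its points.
  have hm : min l (a n) ∉ C := by
    rcases min_choice l (a n) with h | h <;> rw [h]
    · exact hl
    · intro h'
      rw [hC] at h'
      exact lt_irrefl _ (h' n)
  have hle := add_le_add_left' (p := p) (min_le_left l (a n))
  by_cases hex : ∃ x ∈ W, p ≤ x ∧ x < U.add p (min l (a n))
  · obtain ⟨x, hxW, hx, hx'⟩ := hex
    obtain ⟨p', h, hlh, H⟩ := exists_quarter hx hx'
    have hone : U.star (τ := .nat) (1 : ℕ) ∈ C := by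
      rw [hC]
      exact fun n => one_lt_of_lt_of_lt (ha (Nat.lt_succ_self (n + 1))) (ha (Nat.lt_succ_self n))
    -- Otherwise `4 * (h + 1)` would be in the additive cut, and with it the length of the interval.
    -- Hence a point of `W` at distance at least `h` from `x` is impossible.
    have hh : h ∉ C := by
      intro hh
      have hq := hadd _ hh _ hone
      exact hm (hcut.mem_of_le (lt_of_mem_quarterSet hlh rfl).le
        (hadd _ (hadd _ hq _ hq) _ (hadd _ hq _ hq)))
    refine ⟨p', h, hh, fun y hy hy' => ?_⟩
    obtain ⟨h₁, h₂, h₃⟩ := H y hy hy'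
    refine ⟨h₁, lt_of_lt_of_le h₂ hle, fun hyW => hh (hcut.mem_of_le h₃ (hn x hxW y hyW ?_))⟩
    exact lt_of_lt_of_le (dist_lt_of_mem_interval hx hx' h₁ h₂) (min_le_right _ _)
  · push Not at hex
    exact ⟨p, _, hm, fun y h₁ h₂ => ⟨h₁, lt_of_lt_of_le h₂ hle,
      fun hyW => absurd h₂ (not_lt.2 (hex y hyW h₁))⟩⟩

/-- Countably many sets in each of which all small distances are in the cut do not cover. -/
theorem exists_forall_notMem {C : Set U.HNat} (hadd : U.IsAdditive C) {a : ℕ → U.HNat}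
    (ha : StrictAnti a) (hC : C = {x | ∀ n, x < a n}) {W : ℕ → Set U.HNat}
    (hW : ∀ i, ∃ n, ∀ x ∈ W i, ∀ y ∈ W i, U.dist x y < a n → U.dist x y ∈ C) :
    ∃ x, ∀ i, x ∉ W i := by
  have step : ∀ (i : ℕ) (s : U.HNat × {l : U.HNat // l ∉ C}),
      ∃ t : U.HNat × {l : U.HNat // l ∉ C}, ∀ y, t.1 ≤ y → y < U.add t.1 t.2.1 →
        s.1 ≤ y ∧ y < U.add s.1 s.2.1 ∧ y ∉ W i := by
    rintro i ⟨p, l, hl⟩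
    obtain ⟨p', l', hl', h⟩ := exists_subinterval hadd ha hC (hW i) p hl
    exact ⟨⟨p', l', hl'⟩, h⟩
  choose f hf using step
  have h₀ : a 0 ∉ C := by
    rw [hC]
    exact fun h => lt_irrefl _ (h 0)
  let s : ℕ → U.HNat × {l : U.HNat // l ∉ C} := fun n => Nat.rec ⟨a 0, a 0, h₀⟩ (fun i t => f i t) n
  have hs : ∀ n i, i ≤ n → ∀ y, (s n).1 ≤ y → y < U.add (s n).1 (s n).2.1 →
      (s i).1 ≤ y ∧ y < U.add (s i).1 (s i).2.1 := by
    intro n i hi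
    induction n, hi using Nat.le_induction with
    | base => exact fun y h h' => ⟨h, h'⟩
    | succ n hn ih =>
      intro y h h'
      obtain ⟨h₁, h₂, -⟩ := hf n (s n) y h h'
      exact ih y h₁ h₂
  choose A hA using fun n => U.exists_internal (σ := .nat) (Γ := [.nat, .nat])
    (.and (.neg (.mem (.pair .v0 .v1) (.const ltSet))) (.mem (.pair .v0 .v2) (.const ltSet)))
    (((Env.nil _).cons (U.add (s n).1 (s n).2.1)).cons (s n).1)
  obtain ⟨x, hx⟩ := U.saturated _ A fun n => by
    refine ⟨(s n).1, fun i hi => (hA i _).2 (hs n i hi _ le_rfl ?_)⟩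
    -- A length outside the cut is at least some `a m`, which exceeds `a (m + 1)`; so it is positive
    -- and the interval is nonempty.
    obtain ⟨m, hm⟩ : ∃ m, a m ≤ (s n).2.1 := by
      by_contra! hcon
      exact (s n).2.2 (hC.symm.subset hcon)
    exact lt_add_of_lt (lt_of_lt_of_le (ha (Nat.lt_succ_self m)) hm)
  refine ⟨x, fun i => ?_⟩
  have := (hA (i + 1) x).1 (hx (i + 1))
  exact (hf i (s i) x this.1 this.2).2.2

/-! ### Countably determined maps and coinitial cuts -/

/-- On a countably determined graph, membership depends on the generating sets only. -/
theorem mem_of_same_atom {τ : Ty} {G : Set (U.Obj τ)} {X : ℕ → Set (U.Obj τ)} {B : Set (Set ℕ)}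
    (hG : G = ⋃ b ∈ B, ((⋂ m ∈ b, X m) ∩ ⋂ m ∈ bᶜ, ((⋃ n, X n) \ X m))) {z w : U.Obj τ}
    (hz : z ∈ G) (h : ∀ m, w ∈ X m ↔ z ∈ X m) : w ∈ G := by
  rw [hG] at hz ⊢
  simp only [Set.mem_iUnion, Set.mem_inter_iff, Set.mem_iInter, Set.mem_sdiff, h] at hz ⊢
  exact hz

theorem not_CDLE_FD {C : Set U.HNat} (hadd : U.IsAdditive C)
    (hC : U.IsCountablyCoinitialCut C) : ¬ CDLE (U.monadic C) U.FD := by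
  rintro ⟨θ, ⟨X, B, hX, hG⟩, hθ⟩
  obtain ⟨a, ha, hCa⟩ := hC
  have ha' : StrictAnti a := strictAnti_nat_of_succ_lt ha
  let g : U.HNat → U.Obj (.prod .nat (.set .nat)) := fun x => U.pair x (θ ⟨x, trivial⟩).1
  have hgG : ∀ x, g x ∈ graph θ := fun x => ⟨⟨x, trivial⟩, rfl⟩
  -- The cell of points whose graph points have a prescribed membership pattern in the first `t.1`
  -- generating sets; there are only countably many cells.
  let W : ℕ × Finset ℕ → Set U.HNat := fun t => {x | ∀ i < t.1, g x ∈ X i ↔ i ∈ t.2}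
  let Good : ℕ × Finset ℕ → Prop := fun t =>
    ∃ n, ∀ x ∈ W t, ∀ y ∈ W t, U.dist x y < a n → U.dist x y ∈ C
  obtain ⟨e, he⟩ := exists_surjective_nat (ℕ × Finset ℕ)
  obtain ⟨x, hx⟩ := exists_forall_notMem hadd ha' hCa
    (W := fun i => {x | x ∈ W (e i) ∧ Good (e i)}) (fun i => by
      by_cases h : Good (e i)
      · obtain ⟨n, hn⟩ := h
        exact ⟨n, fun x hx y hy => hn x hx.1 y hy.1⟩
      · exact ⟨0, fun x hx => absurd hx.2 h⟩)
  classical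
  let t : ℕ → ℕ × Finset ℕ := fun k => (k, (Finset.range k).filter fun i => g x ∈ X i)
  have hWt : ∀ {k y}, y ∈ W (t k) → ∀ i < k, g y ∈ X i ↔ g x ∈ X i := by
    intro k y hy i hi
    rw [hy i hi]
    simp [t, hi]
  have hbad : ∀ k, ¬ Good (t k) := by
    intro k hk
    obtain ⟨i, hi⟩ := he (t k)
    refine hx i ⟨?_, hi ▸ hk⟩
    rw [hi]
    intro j hj
    change j < k at hj
    simp [t, hj]
  have hA' : ∀ i, ∃ A : U.Obj (.set (.prod .nat (.set .nat))),
      ∀ z, U.mem z A ↔ (z ∈ X i ↔ g x ∈ X i) := by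
    intro i
    obtain ⟨A, hA⟩ := hX i
    by_cases h : g x ∈ X i
    · refine ⟨A, fun z => ?_⟩
      simp only [h, iff_true]
      rw [hA]
      rfl
    · obtain ⟨A', h'⟩ := U.exists_internal (σ := .prod .nat (.set .nat))
        (Γ := [.set (.prod .nat (.set .nat))]) (.neg (.mem .v0 .v1)) ((Env.nil _).cons A)
      refine ⟨A', fun z => ?_⟩
      simp only [h, iff_false]
      rw [hA]
      exact h' z
  choose A hA using hA'
  -- Condition `i`: both points agree with `g x` about `X i`, the first coordinates are less than `a
  -- i` apart, and the second ones differ in at least `i` points. Badness of the cell of length `n +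
  -- 1` satisfies the conditions up to `n`.
  choose K hK using fun i => U.exists_internal₂ (σ := .prod .nat (.set .nat))
    (τ := .prod .nat (.set .nat)) (Γ := [.set (.prod .nat (.set .nat)), .nat])
    (.and (.mem .v0 .v2) (.and (.mem .v1 .v2) (.ex .nat (.ex (.set .nat) (.ex .nat
      (.ex (.set .nat) (.ex .nat (.and (.eq .v5 (.pair .v4 .v3)) (.and (.eq .v6 (.pair .v2 .v1))
      (.and (.mem (.pair (.pair .v4 .v2) .v0) (.const distGraph))
      (.and (.mem (.pair .v0 .v8) (.const ltSet))
        (.mem (.pair .v3 .v1) (.const (symmDiffGE i))))))))))))))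
    (((Env.nil _).cons (a i)).cons (A i))
  obtain ⟨z, w, hzw⟩ := U.saturated₂ K fun n => by
    have hn := hbad (n + 1)
    simp only [Good, not_exists, not_forall] at hn
    obtain ⟨y, hy, y', hy', hlt, hnot⟩ := hn n
    refine ⟨g y, g y', fun i hi => (hK i _ _).2 ⟨?_, ?_, y, _, y', _, _, rfl, rfl,
      dist_spec y y', ?_, ?_⟩⟩
    · exact (hA i _).2 (hWt hy i (by omega))
    · exact (hA i _).2 (hWt hy' i (by omega))
    · exact lt_of_lt_of_le hlt (ha'.antitone hi)
    · have hinf : (symmDiff {x | U.mem x (θ ⟨y, trivial⟩).1}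
          {x | U.mem x (θ ⟨y', trivial⟩).1}).Infinite :=
        fun h => hnot ((hθ ⟨y, trivial⟩ ⟨y', trivial⟩).2 h)
      exact (mem_star_symmDiffGE i _ _).2 (le_top.trans hinf.encard_eq.ge)
  have hzG : z ∈ graph θ := mem_of_same_atom hG (hgG x) fun m =>
    (hA m z).1 ((hK m z w).1 (hzw m)).1
  have hwG : w ∈ graph θ := mem_of_same_atom hG (hgG x) fun m =>
    (hA m w).1 ((hK m z w).1 (hzw m)).2.1
  obtain ⟨y, rfl⟩ := hzG
  obtain ⟨y', rfl⟩ := hwG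
  have key : ∀ i : ℕ, U.dist y.1 y'.1 < a i ∧
      U.mem (U.pair (θ y).1 (θ y').1) (U.star (symmDiffGE i)) := by
    intro i
    obtain ⟨-, -, x₁, s₁, x₂, s₂, d, h₁, h₂, hd, hlt, hge⟩ := (hK i _ _).1 (hzw i)
    obtain ⟨hx₁, hs₁⟩ := pair_inj (U := U) (x' := x₁) (y' := s₁) h₁
    obtain ⟨hx₂, hs₂⟩ := pair_inj (U := U) (x' := x₂) (y' := s₂) h₂
    obtain rfl : d = U.dist x₁ x₂ := eq_app_iff.2 hd
    rw [hx₁, hx₂, hs₁, hs₂]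
    exact ⟨hlt, hge⟩
  have hfin : (symmDiff {x | U.mem x (θ y).1} {x | U.mem x (θ y').1}).Finite :=
    (hθ y y').1 (by
      change U.dist y.1 y'.1 ∈ C
      rw [hCa]
      exact fun i => (key i).1)
  obtain ⟨k, hk⟩ := finite_iff_exists_not_le_encard.1 hfin
  exact hk ((mem_star_symmDiffGE k _ _).1 (key k).2)

end Universe

end NSA

namespace NSA

/-! ## Hamming cubes in families of sets -/

/-- The families of sets that contain a copy of the Hamming cube of words of length `N` over an
alphabet of `t + 1` letters, with distances distorted by a factor of at most two. -/
def hasCube (N t : ℕ) : Set (Set (Set ℕ)) :=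
  {Y | ∃ φ : (Fin N → Fin (t + 1)) → Set ℕ, (∀ w, φ w ∈ Y) ∧
    ∀ w w', (hammingDist w w' : ℕ∞) ≤ (symmDiff (φ w) (φ w')).encard ∧
      (symmDiff (φ w) (φ w')).encard ≤ 2 * (hammingDist w w' : ℕ∞)}

theorem hasCube_of_map {N t N' t' : ℕ} {Z : Set (Set ℕ)}
    (f : (Fin N → Fin (t + 1)) → (Fin N' → Fin (t' + 1)))
    (hf : ∀ w w', hammingDist (f w) (f w') = hammingDist w w') {φ : (Fin N' → Fin (t' + 1)) → Set ℕ}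
    (hφ : ∀ w w', (hammingDist w w' : ℕ∞) ≤ (symmDiff (φ w) (φ w')).encard ∧
      (symmDiff (φ w) (φ w')).encard ≤ 2 * (hammingDist w w' : ℕ∞))
    (hZ : ∀ w, φ (f w) ∈ Z) : Z ∈ hasCube N t :=
  ⟨fun w => φ (f w), hZ, fun w w' => by
    rw [← hf]
    exact hφ _ _⟩

theorem hasCube_anti {N t N' t' : ℕ} (hN : N ≤ N') (ht : t ≤ t') :
    hasCube N' t' ⊆ hasCube N t := by
  rintro Y ⟨φ, hY, hφ⟩
  obtain ⟨k, rfl⟩ := Nat.exists_eq_add_of_le hN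
  -- Short words are padded with zeros, which leaves Hamming distances unchanged.
  refine hasCube_of_map (fun w => Fin.append (fun i => Fin.castLE (by omega) (w i))
    (fun _ : Fin k => 0)) (fun w w' => ?_) hφ (fun w => hY _)
  simp only [hammingDist, Finset.card_filter, Fin.sum_univ_add, Fin.append_left, Fin.append_right]
  simp [Fin.ext_iff]

/-- A word is sent to its graph. Each differing letter contributes one point to either side of the
symmetric difference, whence the distortion factor two. -/
theorem finite_mem_hasCube (N t : ℕ) : {s : Set ℕ | s.Finite} ∈ hasCube N t := by
  have hinj : ∀ w : Fin N → Fin (t + 1),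
      Function.Injective fun i : Fin N => Nat.pair i (w i) := by
    intro w i j h
    exact Fin.ext (Nat.pair_eq_pair.1 h).1
  have hdiff : ∀ w w' : Fin N → Fin (t + 1), (Set.range fun i : Fin N => Nat.pair i (w i)) \
      (Set.range fun i : Fin N => Nat.pair i (w' i)) =
      (fun i : Fin N => Nat.pair i (w i)) '' {i | w i ≠ w' i} := by
    intro w w'
    ext z
    constructor
    · rintro ⟨⟨i, rfl⟩, h⟩
      exact ⟨i, fun he => h ⟨i, by simp only [he]⟩, rfl⟩
    · rintro ⟨i, hi, rfl⟩
      refine ⟨⟨i, rfl⟩, ?_⟩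
      rintro ⟨j, hj⟩
      obtain ⟨h₁, h₂⟩ := Nat.pair_eq_pair.1 hj
      obtain rfl := Fin.ext h₁
      exact hi (Fin.ext h₂).symm
  have hcard : ∀ w w' : Fin N → Fin (t + 1), ((Set.range fun i : Fin N => Nat.pair i (w i)) \
      (Set.range fun i : Fin N => Nat.pair i (w' i))).encard = hammingDist w w' := by
    intro w w'
    rw [hdiff, (hinj w).encard_image, hammingDist, ← Set.encard_coe_eq_coe_finsetCard]
    congr 1
    ext i
    simp
  refine ⟨fun w => Set.range fun i : Fin N => Nat.pair i (w i), fun w => Set.finite_range _,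
    fun w w' => ⟨?_, ?_⟩⟩
  · rw [← hcard]
    exact Set.encard_le_encard Set.subset_union_left
  · refine (Set.encard_union_le _ _).trans ?_
    rw [hcard, hcard, hammingDist_comm w' w, two_mul]

/-- The Ramsey theorem for products: every two-colouring of words over a large alphabet is
constant on the words of some box. -/
theorem exists_mono_box (N t : ℕ) : ∃ K : ℕ, ∀ (α : Type) [Fintype α], K ≤ Fintype.card α →
    ∀ c : (Fin N → α) → Bool, ∃ (e : Fin N → Fin t → α) (b : Bool),
      (∀ i, Function.Injective (e i)) ∧ ∀ w : Fin N → Fin t, c (fun i => e i (w i)) = b := by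
  induction N with
  | zero =>
    refine ⟨0, fun α _ _ c => ⟨fun i => i.elim0, c fun i => i.elim0, fun i => i.elim0, fun w => ?_⟩⟩
    congr 1
    funext i
    exact i.elim0
  | succ N ih =>
    obtain ⟨K, hK⟩ := ih
    -- First letters are classified by the colouring they induce on words over a fixed alphabet of
    -- `K` letters; the bound forces a class of at least `t` letters, whose common colouring `q` is
    -- handled by induction.
    refine ⟨max K (Fintype.card ((Fin N → Fin K) → Bool) * t), fun α _ hα c => ?_⟩
    classical
    obtain ⟨ι⟩ : Nonempty (Fin K ↪ α) :=
      Function.Embedding.nonempty_of_card_le (by simpa using le_trans (le_max_left _ _) hα)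
    obtain ⟨q, hq⟩ := Fintype.exists_le_card_fiber_of_mul_le_card
      (fun a : α => fun w : Fin N → Fin K => c (Fin.cons a fun i => ι (w i)))
      (le_trans (le_max_right _ _) hα)
    obtain ⟨e, b, he, hb⟩ := hK (Fin K) (by simp) q
    obtain ⟨κ⟩ : Nonempty (Fin t ↪ {a : α // a ∈ Finset.univ.filter fun a : α =>
        (fun w : Fin N → Fin K => c (Fin.cons a fun i => ι (w i))) = q}) :=
      Function.Embedding.nonempty_of_card_le (by
        rw [Fintype.card_fin, Fintype.card_coe]
        exact hq)
    refine ⟨Fin.cons (fun j => (κ j).1) fun i j => ι (e i j), b, ?_, ?_⟩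
    · intro i
      refine Fin.cases ?_ (fun i => ?_) i
      · exact fun j j' h => κ.injective (Subtype.ext h)
      · exact fun j j' h => he i (ι.injective h)
    · intro w
      have h₁ := (Finset.mem_filter.1 (κ (w 0)).2).2
      have h₂ := congrFun h₁ fun i => e i (w i.succ)
      rw [hb] at h₂
      rw [← h₂]
      congr 1
      funext i
      refine Fin.cases ?_ (fun i => ?_) i <;> rfl

/-- Colour words by membership in `Y₁`: a monochromatic box is an isometric copy of the smaller
cube. -/
theorem exists_hasCube_split (N t : ℕ) : ∃ K : ℕ, ∀ Y Y₁ Y₂ : Set (Set ℕ), Y ∈ hasCube N K →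
    (∀ u ∈ Y, u ∈ Y₁ ∨ u ∈ Y₂) → Y₁ ∈ hasCube N t ∨ Y₂ ∈ hasCube N t := by
  obtain ⟨K, hK⟩ := exists_mono_box N (t + 1)
  refine ⟨K, ?_⟩
  rintro Y Y₁ Y₂ ⟨φ, hY, hφ⟩ hcov
  classical
  obtain ⟨e, b, he, hb⟩ := hK (Fin (K + 1)) (by simp) fun w => decide (φ w ∈ Y₁)
  have hf : ∀ w w' : Fin N → Fin (t + 1),
      hammingDist (fun i => e i (w i)) (fun i => e i (w' i)) = hammingDist w w' :=
    fun w w' => hammingDist_comp e he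
  cases b with
  | true => exact Or.inl (hasCube_of_map _ hf hφ fun w => of_decide_eq_true (hb w))
  | false => exact Or.inr (hasCube_of_map _ hf hφ fun w =>
      (hcov _ (hY _)).resolve_left (of_decide_eq_false (hb w)))

/-- There is no map from a large cube to the line that is Lipschitz and separates distant points
at the same scale. -/
theorem false_of_hasCube {m : ℕ} {Y : Set (Set ℕ)} (hY : Y ∈ hasCube (m + 1) (2 * (m + 1) + 1))
    {P : Set (Set ℕ × ℕ)} {a : ℕ} (hdom : ∀ u ∈ Y, ∃ x, (u, x) ∈ P)
    (hlip : ∀ u x v y, (u, x) ∈ P → (v, y) ∈ P → ¬ ((3 : ℕ) : ℕ∞) ≤ (symmDiff u v).encard →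
      (x - y) + (y - x) < a)
    (hsep : ∀ u x v y, (u, x) ∈ P → (v, y) ∈ P → (x - y) + (y - x) < a →
      ¬ ((m + 1 : ℕ) : ℕ∞) ≤ (symmDiff u v).encard) : False := by
  obtain ⟨φ, hφY, hφ⟩ := hY
  choose g hg using fun w => hdom _ (hφY w)
  have hstep : ∀ w w', hammingDist w w' ≤ 1 → (g w - g w') + (g w' - g w) < a := by
    intro w w' h
    refine hlip _ _ _ _ (hg w) (hg w') fun h3 => ?_
    have h₁ := h3.trans (hφ w w').2
    have h₂ : 3 ≤ 2 * hammingDist w w' := by exact_mod_cast h₁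
    omega
  -- The path from the zero word to the constant word `j`, changing one letter at a time.
  let p : Fin (2 * (m + 1) + 1 + 1) → ℕ → Fin (m + 1) → Fin (2 * (m + 1) + 1 + 1) :=
    fun j k i => if i.1 < k then j else 0
  have hp : ∀ j k, hammingDist (p j k) (p j (k + 1)) ≤ 1 := by
    intro j k
    refine Finset.card_le_one.2 fun i hi i' hi' => ?_
    have key : ∀ i : Fin (m + 1), p j k i ≠ p j (k + 1) i → i.1 = k := by
      intro i hi
      by_contra hne
      apply hi
      simp only [p]
      congr 1
      exact propext (by omega)
    have h₁ := key i (Finset.mem_filter.1 hi).2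
    have h₂ := key i' (Finset.mem_filter.1 hi').2
    exact Fin.ext (h₁.trans h₂.symm)
  have hpath : ∀ j k, (g (p j k) - g (p j 0)) + (g (p j 0) - g (p j k)) ≤ k * a := by
    intro j k
    induction k with
    | zero => simp
    | succ k ih =>
      have := hstep _ _ (hp j k)
      rw [Nat.succ_mul]
      omega
  have ha : 0 < a := lt_of_le_of_lt (Nat.zero_le _) (hstep (fun _ => 0) (fun _ => 0) (by simp))
  let x₀ := g fun _ => 0
  have hp0 : ∀ j, g (p j 0) = x₀ := fun j => by
    have : p j 0 = fun _ => 0 := funext fun i => by simp [p]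
    rw [this]
  have hpm : ∀ j, p j (m + 1) = fun _ => j := fun j => funext fun i => by simp [p, i.2]
  have hbound : ∀ j, (g (fun _ => j) - x₀) + (x₀ - g fun _ => j) ≤ (m + 1) * a := fun j => by
    have := hpath j (m + 1)
    rwa [hp0, hpm] at this
  -- The block of length `a` that contains the image of the constant word `j`. Adding `(m + 1) * a`
  -- first keeps the subtraction from truncating. There is one block fewer than there are letters.
  let q : Fin (2 * (m + 1) + 1 + 1) → Fin (2 * (m + 1) + 1) := fun j =>
    ⟨(g (fun _ => j) + (m + 1) * a - x₀) / a, by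
      rw [Nat.div_lt_iff_lt_mul ha]
      have := hbound j
      have e : (2 * (m + 1) + 1) * a = (m + 1) * a + (m + 1) * a + a := by ring
      omega⟩
  obtain ⟨j, j', hne, hq⟩ := Fintype.exists_ne_map_eq_of_card_lt q (by simp)
  have hq' : (g (fun _ => j) + (m + 1) * a - x₀) / a = (g (fun _ => j') + (m + 1) * a - x₀) / a :=
    congrArg Fin.val hq
  have hb := hbound j
  have hb' := hbound j'
  have h₁ := Nat.div_add_mod (g (fun _ => j) + (m + 1) * a - x₀) a
  have h₂ := Nat.div_add_mod (g (fun _ => j') + (m + 1) * a - x₀) a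
  have h₃ := Nat.mod_lt (g (fun _ => j) + (m + 1) * a - x₀) ha
  have h₄ := Nat.mod_lt (g (fun _ => j') + (m + 1) * a - x₀) ha
  rw [hq'] at h₁
  refine hsep _ _ _ _ (hg fun _ => j) (hg fun _ => j') (by omega) (le_trans ?_ (hφ _ _).1)
  have : hammingDist (fun _ : Fin (m + 1) => j) (fun _ => j') = m + 1 := by
    simp [hammingDist, hne]
  rw [this]

end NSA

namespace NSA

namespace Universe

variable {U : Universe.{u}}

/-! ## Large internal families of sets -/

/-- The families of sets that contain a cube. -/
abbrev cubeSet (N t : ℕ) : (Ty.set (.set (.set .nat))).Std := hasCube N t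

/-- The sets of pairs whose domain contains a cube. -/
abbrev domCubeSet (N t : ℕ) : (Ty.set (.set (.prod (.set .nat) .nat))).Std :=
  {P : Set (Set ℕ × ℕ) | {u | ∃ x, (u, x) ∈ P} ∈ hasCube N t}

/-- An internal family is large if it contains cubes of all standard finite sizes. -/
def Large (Y : U.Obj (.set (.set .nat))) : Prop := ∀ N t, U.mem Y (U.star (cubeSet N t))

theorem Large.exists_mem {Y : U.Obj (.set (.set .nat))} (hY : Large Y) : ∃ u, U.mem u Y :=
  (U.transfer (.all (.set (.set .nat)) (.imp (.mem .v0 (.const (cubeSet 0 0)))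
    (.ex (.set .nat) (.mem .v0 .v1))))).1 (by
      have h : ∀ Y : Set (Set ℕ), Y ∈ hasCube 0 0 → ∃ u, u ∈ Y :=
        fun Y ⟨φ, hφ, _⟩ => ⟨_, hφ fun _ => 0⟩
      exact h) Y (hY 0 0)

theorem mem_cubeSet_anti {Y : U.Obj (.set (.set .nat))} {N t N' t' : ℕ} (hN : N ≤ N')
    (ht : t ≤ t') : U.mem Y (U.star (cubeSet N' t')) → U.mem Y (U.star (cubeSet N t)) :=
  (U.transfer (.all (.set (.set .nat)) (.imp (.mem .v0 (.const (cubeSet N' t')))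
    (.mem .v0 (.const (cubeSet N t)))))).1 (by
      have h : ∀ Y : Set (Set ℕ), Y ∈ hasCube N' t' → Y ∈ hasCube N t :=
        fun Y h => hasCube_anti hN ht h
      exact h) Y

/-- If the parts omit cubes of two sizes, both omit the cube of the maximal size, against the Ramsey
splitting of a larger cube in `Y`. -/
theorem Large.split {Y Y₁ Y₂ : U.Obj (.set (.set .nat))} (hY : Large Y)
    (h : ∀ u, U.mem u Y → U.mem u Y₁ ∨ U.mem u Y₂) : Large Y₁ ∨ Large Y₂ := by
  by_contra! hcon
  simp only [Large, not_forall] at hcon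
  obtain ⟨⟨N₁, t₁, h₁⟩, N₂, t₂, h₂⟩ := hcon
  obtain ⟨K, hK⟩ := exists_hasCube_split (max N₁ N₂) (max t₁ t₂)
  rcases (U.transfer (.all (.set (.set .nat)) (.all (.set (.set .nat)) (.all (.set (.set .nat))
    (.imp (.mem .v2 (.const (cubeSet (max N₁ N₂) K)))
    (.imp (.all (.set .nat) (.imp (.mem .v0 .v3) (.or (.mem .v0 .v2) (.mem .v0 .v1))))
    (.or (.mem .v1 (.const (cubeSet (max N₁ N₂) (max t₁ t₂))))
      (.mem .v0 (.const (cubeSet (max N₁ N₂) (max t₁ t₂))))))))))).1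
      hK Y Y₁ Y₂ (hY _ _) h with h | h
  · exact h₁ (mem_cubeSet_anti (le_max_left _ _) (le_max_left _ _) h)
  · exact h₂ (mem_cubeSet_anti (le_max_right _ _) (le_max_right _ _) h)

/-- Saturation for decreasing sequences of internal sets with standard properties. -/
theorem exists_subset_of_antitone {τ : Ty} (B : ℕ → (Ty.set (.set τ)).Std)
    (Q : ℕ → U.Obj (.set τ)) (hQ : ∀ n x, U.mem x (Q (n + 1)) → U.mem x (Q n))
    (hB : ∀ n i, U.mem (Q n) (U.star (B i))) :
    ∃ Q', (∀ n x, U.mem x Q' → U.mem x (Q n)) ∧ ∀ i, U.mem Q' (U.star (B i)) := by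
  choose K hK using fun i => U.exists_internal (σ := .set τ) (Γ := [.set τ])
    (.and (.all τ (.imp (.mem .v0 .v1) (.mem .v0 .v2))) (.mem .v0 (.const (B i))))
    ((Env.nil _).cons (Q i))
  obtain ⟨Q', hQ'⟩ := U.saturated _ K fun n => by
    refine ⟨Q n, fun i hi => (hK i _).2 ⟨?_, hB n i⟩⟩
    induction n, hi using Nat.le_induction with
    | base => exact fun x h => h
    | succ n hn ih => exact fun x h => ih x (hQ n x h)
  exact ⟨Q', fun n x h => ((hK n _).1 (hQ' n)).1 x h, fun i => ((hK i _).1 (hQ' i)).2⟩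

/-! ### Density below large families -/

/-- A set of internal sets is dense below a large family if it meets all large subfamilies. -/
def DenseBelow (D : Set (U.Obj (.set .nat))) (Y : U.Obj (.set (.set .nat))) : Prop :=
  Large Y ∧ ∀ Y', Large Y' → (∀ u, U.mem u Y' → U.mem u Y) → ∃ u ∈ D, U.mem u Y'

/-- A Baire category argument: otherwise shrink `Y` successively to large families that miss `D 0`,
`D 1`, and so on. Saturation gives a large family below all of them, which misses the whole union.
-/
theorem DenseBelow.exists_of_iUnion {D : ℕ → Set (U.Obj (.set .nat))}
    {Y : U.Obj (.set (.set .nat))} (h : DenseBelow (⋃ k, D k) Y) :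
    ∃ k Y', (∀ u, U.mem u Y' → U.mem u Y) ∧ DenseBelow (D k) Y' := by
  by_contra! hcon
  have step : ∀ (k : ℕ) (Z : {Z // Large Z ∧ ∀ u, U.mem u Z → U.mem u Y}),
      ∃ Z' : {Z // Large Z ∧ ∀ u, U.mem u Z → U.mem u Y},
        (∀ u, U.mem u Z'.1 → U.mem u Z.1) ∧ ∀ u ∈ D k, ¬ U.mem u Z'.1 := by
    rintro k ⟨Z, hZ, hZY⟩
    have := hcon k Z hZY
    simp only [DenseBelow, not_and, not_forall, not_exists] at this
    obtain ⟨Z', h₁, h₂, h₃⟩ := this hZ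
    exact ⟨⟨Z', h₁, fun u hu => hZY u (h₂ u hu)⟩, h₂, h₃⟩
  choose f hf hf' using step
  let Z : ℕ → {Z // Large Z ∧ ∀ u, U.mem u Z → U.mem u Y} :=
    fun n => Nat.rec ⟨Y, h.1, fun _ h => h⟩ (fun k Z => f k Z) n
  obtain ⟨Q, hQ, hQL⟩ := exists_subset_of_antitone
    (fun i => cubeSet (Nat.unpair i).1 (Nat.unpair i).2) (fun n => (Z n).1)
    (fun n => hf n (Z n)) (fun n i => (Z n).2.1 _ _)
  obtain ⟨u, hu, huQ⟩ := h.2 Q (fun N t => by simpa using hQL (Nat.pair N t)) (hQ 0)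
  obtain ⟨k, hk⟩ := Set.mem_iUnion.1 hu
  exact hf' k (Z k) u hk (hQ (k + 1) u huQ)

theorem exists_internal_iInter {τ : Ty} (A : ℕ → U.Obj (.set τ)) (n : ℕ) :
    ∃ H : U.Obj (.set τ), ∀ z, U.mem z H ↔ ∀ i ≤ n, U.mem z (A i) := by
  induction n with
  | zero => exact ⟨A 0, fun z => by simp⟩
  | succ n ih =>
    obtain ⟨H, hH⟩ := ih
    obtain ⟨H', hH'⟩ := U.exists_internal (σ := τ) (Γ := [.set τ, .set τ])
      (.and (.mem .v0 .v1) (.mem .v0 .v2)) (((Env.nil _).cons (A (n + 1))).cons H)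
    refine ⟨H', fun z => (hH' z).trans ⟨?_, ?_⟩⟩
    · rintro ⟨h, h'⟩ i hi
      rcases Nat.le_succ_iff.1 hi with hi | rfl
      · exact (hH z).1 h i hi
      · exact h'
    · exact fun h => ⟨(hH z).2 fun i hi => h i (by omega), h _ le_rfl⟩

theorem mem_domCubeSet {P : U.Obj (.set (.prod (.set .nat) .nat))}
    {E : U.Obj (.set (.set .nat))} (h : ∀ u, U.mem u E ↔ ∃ x, U.mem (U.pair u x) P) {N t : ℕ}
    (hE : U.mem E (U.star (cubeSet N t))) : U.mem P (U.star (domCubeSet N t)) :=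
  (U.transfer (.all (.set (.prod (.set .nat) .nat)) (.all (.set (.set .nat))
    (.imp (.all (.set .nat) (.iff (.mem .v0 .v1) (.ex .nat (.mem (.pair .v1 .v0) .v3))))
    (.imp (.mem .v0 (.const (cubeSet N t))) (.mem .v1 (.const (domCubeSet N t)))))))).1 (by
      have h : ∀ (P : Set (Set ℕ × ℕ)) (E : Set (Set ℕ)),
          (∀ u, (u ∈ E → ∃ x, (u, x) ∈ P) ∧ ((∃ x, (u, x) ∈ P) → u ∈ E)) → E ∈ hasCube N t →
            {u | ∃ x, (u, x) ∈ P} ∈ hasCube N t := by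
        intro P E h hE
        have : {u | ∃ x, (u, x) ∈ P} = E := Set.ext fun u => ⟨(h u).2, (h u).1⟩
        rwa [this]
      exact h) P E (fun u => ⟨(h u).1, (h u).2⟩) hE

/-! ## Internal subsets of Borel sets -/

open Classical in
/-- The sequence of truth values of membership in the sets of a sequence. -/
noncomputable def membershipCode {α : Type*} (X : ℕ → Set α) (z : α) : ℕ → Bool :=
  fun m => decide (z ∈ X m)

/-- A Borel set depends on countably many internal sets only, through a Borel set of the Cantor
space; this makes the theory of analytic sets applicable. -/
theorem IsBorel.exists_code {τ : Ty} {s : Set (U.Obj τ)} (hs : U.IsBorel s) :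
    ∃ X : ℕ → Set (U.Obj τ), (∀ m, U.IsInternal (X m)) ∧ ∃ B : Set (ℕ → Bool),
      MeasurableSet B ∧ s = membershipCode X ⁻¹' B := by
  induction s, hs using MeasurableSpace.generateFrom_induction with
  | hC s hs _ =>
    refine ⟨fun _ => s, fun _ => hs, {c | c 0 = true}, ?_, ?_⟩
    · have h : Measurable fun c : ℕ → Bool => c 0 := measurable_pi_apply 0
      exact h (measurableSet_singleton true)
    · ext z
      simp [membershipCode]
  | empty =>
    obtain ⟨A, -⟩ := U.exists_internal (σ := τ) (Γ := []) (.eq .v0 .v0) (Env.nil _)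
    exact ⟨fun _ => {x | U.mem x A}, fun _ => ⟨A, rfl⟩, ∅, MeasurableSet.empty, rfl⟩
  | compl s _ ih =>
    obtain ⟨X, hX, B, hB, rfl⟩ := ih
    exact ⟨X, hX, Bᶜ, hB.compl, rfl⟩
  | iUnion s _ ih =>
    choose X hX B hB hs using ih
    refine ⟨fun m => X (Nat.unpair m).1 (Nat.unpair m).2, fun m => hX _ _,
      ⋃ n, (fun c i => c (Nat.pair n i)) ⁻¹' B n, MeasurableSet.iUnion fun n => ?_, ?_⟩
    · exact measurable_pi_lambda _ (fun i => measurable_pi_apply (Nat.pair n i)) (hB n)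
    · rw [Set.preimage_iUnion]
      refine Set.iUnion_congr fun n => ?_
      rw [hs n]
      ext z
      have hz : membershipCode (X n) z = fun i => membershipCode
          (fun m => X (Nat.unpair m).1 (Nat.unpair m).2) z (Nat.pair n i) := by
        funext i
        exact decide_eq_decide.2 (by simp only [Nat.unpair_pair])
      rw [Set.mem_preimage, hz]
      rfl

/-- Neighbourhoods in the Baire space contain cylinders. -/
theorem exists_cylinder_subset {F : (ℕ → ℕ) → (ℕ → Bool)} (hF : Continuous F) (f : ℕ → ℕ)
    (n : ℕ) : ∃ k, ∀ g : ℕ → ℕ, (∀ i < k, g i = f i) → ∀ i ≤ n, F g i = F f i := by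
  have hopen : IsOpen (⋂ i ∈ Finset.range (n + 1), {g | F g i = F f i}) := by
    refine isOpen_biInter_finset fun i _ => ?_
    exact (isOpen_discrete {F f i}).preimage ((continuous_apply i).comp hF)
  obtain ⟨I, u, hu, hsub⟩ := isOpen_pi_iff.1 hopen f (by simp)
  refine ⟨I.sup id + 1, fun g hg i hi => ?_⟩
  have hmem : g ∈ (I : Set ℕ).pi u := by
    intro j hj
    rw [hg j (Nat.lt_succ_of_le (Finset.le_sup (f := id) hj))]
    exact (hu j hj).2
  have := hsub hmem
  simp only [Set.mem_iInter] at this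
  exact this i (Finset.mem_range.2 (by omega))

/-- A Borel set of pairs with dense domain has an internal subset with large domain. -/
theorem IsBorel.exists_internal_subset {G : Set (U.Obj (.prod (.set .nat) .nat))}
    (hG : U.IsBorel G) {Y : U.Obj (.set (.set .nat))}
    (hY : DenseBelow {u | ∃ x, U.pair u x ∈ G} Y) :
    ∃ P : U.Obj (.set (.prod (.set .nat) .nat)), (∀ z, U.mem z P → z ∈ G) ∧
      ∀ N t, U.mem P (U.star (domCubeSet N t)) := by
  obtain ⟨X, hX, B, hB, rfl⟩ := hG.exists_code
  have hBF : ∃ F : (ℕ → ℕ) → (ℕ → Bool), Continuous F ∧ Set.range F = B := by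
    have : TopologicalSpace.SeparableSpace (ℕ → Bool) := inferInstance
    have : TopologicalSpace.IsCompletelyMetrizableSpace (ℕ → Bool) := inferInstance
    have : PolishSpace (ℕ → Bool) := inferInstance
    have hBA := hB.analyticSet
    rw [MeasureTheory.AnalyticSet] at hBA
    rcases hBA with rfl | h
    · obtain ⟨u, ⟨x, hx⟩, -⟩ := hY.2 Y hY.1 fun _ h => h
      exact absurd hx (Set.notMem_empty _)
    · exact h
  obtain ⟨F, hF, rfl⟩ := hBF
  -- The part of the domain witnessed by parameters in `S`. Splitting `S` by its next coordinate is
  -- a countable union, so one value can be fixed while density is kept below a smaller large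
  -- family.
  let D : Set (ℕ → ℕ) → Set (U.Obj (.set .nat)) := fun S =>
    {u | ∃ x, ∃ g ∈ S, F g = membershipCode X (U.pair u x)}
  have step : ∀ (n : ℕ) (s : {s : Set (ℕ → ℕ) × U.Obj (.set (.set .nat)) //
      DenseBelow (D s.1) s.2}), ∃ (k : ℕ) (t : {s : Set (ℕ → ℕ) × U.Obj (.set (.set .nat)) //
      DenseBelow (D s.1) s.2}), t.1.1 = s.1.1 ∩ {g | g n = k} ∧
        ∀ u, U.mem u t.1.2 → U.mem u s.1.2 := by
    rintro n ⟨⟨S, Z⟩, hs⟩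
    have hD : D S = ⋃ k, D (S ∩ {g | g n = k}) := by
      ext u
      simp only [D, Set.mem_iUnion]
      constructor
      · rintro ⟨x, g, hg, h⟩
        exact ⟨g n, x, g, ⟨hg, rfl⟩, h⟩
      · rintro ⟨k, x, g, hg, h⟩
        exact ⟨x, g, hg.1, h⟩
    have hs' : DenseBelow (D S) Z := hs
    rw [hD] at hs'
    obtain ⟨k, Z', hZ', h⟩ := hs'.exists_of_iUnion
    exact ⟨k, ⟨⟨_, Z'⟩, h⟩, rfl, hZ'⟩
  choose κ T hT hT' using step
  have h₀ : DenseBelow (D Set.univ) Y := by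
    convert hY using 2
    ext u
    constructor
    · rintro ⟨x, g, -, h⟩
      exact ⟨x, g, h⟩
    · rintro ⟨x, g, h⟩
      exact ⟨x, g, trivial, h⟩
  let s : ℕ → {s : Set (ℕ → ℕ) × U.Obj (.set (.set .nat)) // DenseBelow (D s.1) s.2} :=
    fun n => Nat.rec ⟨⟨Set.univ, Y⟩, h₀⟩ (fun n s => T n s) n
  let f : ℕ → ℕ := fun n => κ n (s n)
  have hS : ∀ n, ∀ g ∈ (s n).1.1, ∀ i < n, g i = f i := by
    intro n
    induction n with
    | zero => exact fun g _ i hi => absurd hi (Nat.not_lt_zero i)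
    | succ n ih =>
      intro g hg i hi
      have hg' : g ∈ (s n).1.1 ∩ {g | g n = f n} := (hT n (s n)).subset hg
      rcases Nat.lt_succ_iff_lt_or_eq.1 hi with hi | rfl
      · exact ih g hg'.1 i hi
      · exact hg'.2
  have hanti : ∀ n m, n ≤ m → ∀ u, U.mem u (s m).1.2 → U.mem u (s n).1.2 := by
    intro n m hnm
    induction m, hnm using Nat.le_induction with
    | base => exact fun u h => h
    | succ m hm ih => exact fun u h => ih u (hT' m (s m) u h)
  have hA : ∀ i, ∃ A : U.Obj (.set (.prod (.set .nat) .nat)),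
      ∀ z, U.mem z A ↔ membershipCode X z i = F f i := by
    intro i
    obtain ⟨A, hA⟩ := hX i
    cases F f i with
    | true =>
      refine ⟨A, fun z => ?_⟩
      simp only [membershipCode, decide_eq_true_eq]
      rw [hA]
      rfl
    | false =>
      obtain ⟨A', h'⟩ := U.exists_internal (σ := .prod (.set .nat) .nat)
        (Γ := [.set (.prod (.set .nat) .nat)]) (.neg (.mem .v0 .v1)) ((Env.nil _).cons A)
      refine ⟨A', fun z => ?_⟩
      simp only [membershipCode, decide_eq_false_iff_not]
      rw [hA]
      exact h' z
  choose A hA using hA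
  choose H hH using fun n => exists_internal_iInter A n
  -- Internal approximations: pairs whose code agrees with `F f` up to `n` and whose first entry is
  -- in the `n`-th family. Any pair in all `Q n` has code `F f` and is in the Borel set.
  choose Q hQ using fun n => U.exists_internal₂ (σ := .set .nat) (τ := .nat)
    (Γ := [.set (.prod (.set .nat) .nat), .set (.set .nat)])
    (.and (.mem (.pair .v0 .v1) .v2) (.mem .v0 .v3)) (((Env.nil _).cons (s n).1.2).cons (H n))
  choose E hE using fun n => U.exists_internal (σ := .set .nat)
    (Γ := [.set (.prod (.set .nat) .nat)]) (.ex .nat (.mem (.pair .v1 .v0) .v2))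
    ((Env.nil _).cons (Q n))
  -- By continuity, parameters that agree with `f` long enough give the right code up to `n`. If the
  -- rest of the family outside `E n` were large, density would put such a pair there.
  have hlarge : ∀ n, Large (E n) := by
    intro n
    obtain ⟨k, hk⟩ := exists_cylinder_subset hF f n
    let m := max n k
    obtain ⟨R, hR⟩ := U.exists_internal (σ := .set .nat) (Γ := [.set (.set .nat), .set (.set .nat)])
      (.and (.mem .v0 .v1) (.neg (.mem .v0 .v2))) (((Env.nil _).cons (E n)).cons (s m).1.2)
    refine ((s m).2.1.split (Y₁ := E n) (Y₂ := R) fun u hu => ?_).resolve_right fun hRL => ?_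
    · by_cases h : U.mem u (E n)
      · exact Or.inl h
      · exact Or.inr ((hR u).2 ⟨hu, h⟩)
    · obtain ⟨u, ⟨x, g, hg, hgc⟩, hu⟩ := (s m).2.2 R hRL fun u hu => ((hR u).1 hu).1
      obtain ⟨hum, huE⟩ := (hR u).1 hu
      refine huE ((hE n u).2 ⟨x, (hQ n _ _).2 ⟨(hH n _).2 fun i hi => (hA i _).2 ?_,
        hanti n m (le_max_left _ _) u hum⟩⟩)
      rw [← hk g (fun j hj => hS m g hg j (lt_of_lt_of_le hj (le_max_right _ _))) i hi]
      exact (congrFun hgc i).symm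
  obtain ⟨P, hP, hPL⟩ := exists_subset_of_antitone
    (fun i => domCubeSet (Nat.unpair i).1 (Nat.unpair i).2) Q (fun n z hz => by
      obtain ⟨u, x, rfl⟩ := exists_eq_pair z
      obtain ⟨h₁, h₂⟩ := (hQ (n + 1) u x).1 hz
      exact (hQ n u x).2 ⟨(hH n _).2 fun i hi => (hH (n + 1) _).1 h₁ i (by omega),
        hanti n (n + 1) (Nat.le_succ n) u h₂⟩)
    (fun n i => mem_domCubeSet (hE n) (hlarge n _ _))
  refine ⟨P, fun z hz => ⟨f, funext fun i => ?_⟩, fun N t => by simpa using hPL (Nat.pair N t)⟩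
  obtain ⟨u, x, rfl⟩ := exists_eq_pair z
  exact ((hA i _).1 ((hH i _).1 ((hQ i u x).1 (hP i _ hz)).1 i le_rfl)).symm

/-! ## Equality modulo finite sets is not reducible to the relation of a cut -/

/-- Countable saturation for pairs of elements of an internal relation. -/
theorem exists_pair_of_saturated {P : U.Obj (.set (.prod (.set .nat) .nat))}
    {R : ℕ → U.Obj (.set (.prod (.prod (.set .nat) (.set .nat)) .nat))}
    (h : ∀ n, ∃ u x v y, U.mem (U.pair u x) P ∧ U.mem (U.pair v y) P ∧
      ∀ i ≤ n, U.mem (U.pair (U.pair u v) (U.dist x y)) (R i)) :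
    ∃ u x v y, U.mem (U.pair u x) P ∧ U.mem (U.pair v y) P ∧
      ∀ i, U.mem (U.pair (U.pair u v) (U.dist x y)) (R i) := by
  choose K hK using fun i => U.exists_internal₂ (σ := .prod (.set .nat) .nat)
    (τ := .prod (.set .nat) .nat) (Γ := [.set (.prod (.set .nat) .nat),
      .set (.prod (.prod (.set .nat) (.set .nat)) .nat)])
    (.and (.mem .v0 .v2) (.and (.mem .v1 .v2) (.ex (.set .nat) (.ex .nat (.ex (.set .nat)
      (.ex .nat (.ex .nat (.and (.eq .v5 (.pair .v4 .v3)) (.and (.eq .v6 (.pair .v2 .v1))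
      (.and (.mem (.pair (.pair .v3 .v1) .v0) (.const distGraph))
        (.mem (.pair (.pair .v4 .v2) .v0) .v8)))))))))))
    (((Env.nil _).cons (R i)).cons P)
  obtain ⟨z, w, hzw⟩ := U.saturated₂ K fun n => by
    obtain ⟨u, x, v, y, hu, hv, hn⟩ := h n
    exact ⟨_, _, fun i hi => (hK i _ _).2
      ⟨hu, hv, u, x, v, y, _, rfl, rfl, dist_spec x y, hn i hi⟩⟩
  obtain ⟨u, x, rfl⟩ := exists_eq_pair z
  obtain ⟨v, y, rfl⟩ := exists_eq_pair w
  refine ⟨u, x, v, y, ((hK 0 _ _).1 (hzw 0)).1, ((hK 0 _ _).1 (hzw 0)).2.1, fun i => ?_⟩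
  obtain ⟨-, -, u', x', v', y', d, h₁, h₂, hd, hi⟩ := (hK i _ _).1 (hzw i)
  obtain ⟨hu, hx⟩ := pair_inj (U := U) (x' := u') (y' := x') h₁
  obtain ⟨hv, hy⟩ := pair_inj (U := U) (x' := v') (y' := y') h₂
  obtain rfl : d = U.dist x' y' := eq_app_iff.2 hd
  rw [hu, hx, hv, hy]
  exact hi

theorem false_of_domCubeSet {m : ℕ} {P : U.Obj (.set (.prod (.set .nat) .nat))} {a : U.HNat}
    (hP : U.mem P (U.star (domCubeSet (m + 1) (2 * (m + 1) + 1))))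
    (hlip : ∀ u x v y, U.mem (U.pair u x) P → U.mem (U.pair v y) P →
      ¬ U.mem (U.pair u v) (U.star (symmDiffGE 3)) → U.dist x y < a)
    (hsep : ∀ u x v y, U.mem (U.pair u x) P → U.mem (U.pair v y) P → U.dist x y < a →
      ¬ U.mem (U.pair u v) (U.star (symmDiffGE (m + 1)))) : False := by
  refine (U.transfer (.all (.set (.prod (.set .nat) .nat)) (.all .nat
    (.imp (.mem .v1 (.const (domCubeSet (m + 1) (2 * (m + 1) + 1))))
    (.imp (.all (.set .nat) (.all .nat (.all (.set .nat) (.all .nat (.all .nat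
      (.imp (.mem (.pair .v4 .v3) .v6) (.imp (.mem (.pair .v2 .v1) .v6)
      (.imp (.mem (.pair (.pair .v3 .v1) .v0) (.const distGraph))
      (.imp (.neg (.mem (.pair .v4 .v2) (.const (symmDiffGE 3))))
        (.mem (.pair .v0 .v5) (.const ltSet)))))))))))
    (.neg (.all (.set .nat) (.all .nat (.all (.set .nat) (.all .nat (.all .nat
      (.imp (.mem (.pair .v4 .v3) .v6) (.imp (.mem (.pair .v2 .v1) .v6)
      (.imp (.mem (.pair (.pair .v3 .v1) .v0) (.const distGraph))
      (.imp (.mem (.pair .v0 .v5) (.const ltSet))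
        (.neg (.mem (.pair .v4 .v2) (.const (symmDiffGE (m + 1)))))))))))))))))))).1 (by
      have h : ∀ (P : Set (Set ℕ × ℕ)) (a : ℕ),
          {u | ∃ x, (u, x) ∈ P} ∈ hasCube (m + 1) (2 * (m + 1) + 1) →
          (∀ (u : Set ℕ) (x : ℕ) (v : Set ℕ) (y d : ℕ), (u, x) ∈ P → (v, y) ∈ P →
            d = (x - y) + (y - x) → ¬ ((3 : ℕ) : ℕ∞) ≤ (symmDiff u v).encard → d < a) →
          ¬ ∀ (u : Set ℕ) (x : ℕ) (v : Set ℕ) (y d : ℕ), (u, x) ∈ P → (v, y) ∈ P →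
            d = (x - y) + (y - x) → d < a →
              ¬ ((m + 1 : ℕ) : ℕ∞) ≤ (symmDiff u v).encard := by
        intro P a hP hlip hsep
        exact false_of_hasCube hP (fun u hu => hu)
          (fun u x v y h h' => hlip u x v y _ h h' rfl)
          (fun u x v y h h' => hsep u x v y _ h h' rfl)
      exact h) P a hP ?_ ?_
  · intro u x v y d hu hv hd hlt
    obtain rfl : d = U.dist x y := eq_app_iff.2 hd
    exact hlip u x v y hu hv hlt
  · intro u x v y d hu hv hd hlt
    obtain rfl : d = U.dist x y := eq_app_iff.2 hd
    exact hsep u x v y hu hv hlt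

theorem denseBelow_finSets {D : Set (U.Obj (.set .nat))} (hD : U.hyperfinite ⊆ D) :
    DenseBelow D (U.star finSets) := by
  refine ⟨fun N t => star_mem_star (σ := .set (.set .nat)) (A := cubeSet N t).2
    (finite_mem_hasCube N t), fun Y hY hsub => ?_⟩
  obtain ⟨u, hu⟩ := hY.exists_mem
  exact ⟨u, hD (hsub u hu), hu⟩

theorem not_borelLE_monadic {C : Set U.HNat} (hC : U.IsCountablyCofinalCut C) :
    ¬ BorelLE U.FD (U.monadic C) := by
  rintro ⟨θ, hG, hθ⟩
  obtain ⟨a, ha, hCa⟩ := hC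
  have ha' : StrictMono a := strictMono_nat_of_lt_succ ha
  obtain ⟨P, hPG, hP⟩ := hG.exists_internal_subset (Y := U.star finSets)
    (denseBelow_finSets fun u hu => ⟨(θ ⟨u, hu⟩).1, ⟨u, hu⟩, rfl⟩)
  have hred : ∀ u x v y, U.mem (U.pair u x) P → U.mem (U.pair v y) P →
      ((symmDiff {z | U.mem z u} {z | U.mem z v}).Finite ↔ ∃ n, U.dist x y < a n) := by
    intro u x v y hu hv
    obtain ⟨u', hu'⟩ := hPG _ hu
    obtain ⟨v', hv'⟩ := hPG _ hv
    obtain ⟨rfl, rfl⟩ := pair_inj (U := U) hu'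
    obtain ⟨rfl, rfl⟩ := pair_inj (U := U) hv'
    have := hθ u' v'
    change _ ↔ U.dist _ _ ∈ C at this
    rw [hCa] at this
    exact this
  -- If no `a n` worked, saturation would give a pair in `P` with small symmetric difference and
  -- distance outside the cut.
  have hlip : ∃ n, ∀ u x v y, U.mem (U.pair u x) P → U.mem (U.pair v y) P →
      ¬ U.mem (U.pair u v) (U.star (symmDiffGE 3)) → U.dist x y < a n := by
    by_contra! hcon
    choose R hR using fun i => U.exists_internal₂ (σ := .prod (.set .nat) (.set .nat)) (τ := .nat)
      (Γ := [.nat]) (.and (.neg (.mem .v0 (.const (symmDiffGE 3))))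
        (.neg (.mem (.pair .v1 .v2) (.const ltSet)))) ((Env.nil _).cons (a i))
    obtain ⟨u, x, v, y, hu, hv, h⟩ := exists_pair_of_saturated (P := P) (R := R) fun n => by
      obtain ⟨u, x, v, y, hu, hv, h₁, h₂⟩ := hcon n
      exact ⟨u, x, v, y, hu, hv, fun i hi => (hR i _ _).2
        ⟨h₁, not_lt.2 ((ha'.monotone hi).trans h₂)⟩⟩
    obtain ⟨n, hn⟩ := (hred u x v y hu hv).1 (finite_iff_exists_not_le_encard.2
      ⟨3, fun h3 => ((hR 0 _ _).1 (h 0)).1 ((mem_star_symmDiffGE 3 u v).2 h3)⟩)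
    exact ((hR n _ _).1 (h n)).2 hn
  obtain ⟨n, hlip⟩ := hlip
  -- If no `m` worked, saturation would give a pair in `P` with distance below `a n` and infinite
  -- symmetric difference.
  have hsep : ∃ m, ∀ u x v y, U.mem (U.pair u x) P → U.mem (U.pair v y) P → U.dist x y < a n →
      ¬ U.mem (U.pair u v) (U.star (symmDiffGE (m + 1))) := by
    by_contra! hcon
    choose R hR using fun i => U.exists_internal₂ (σ := .prod (.set .nat) (.set .nat)) (τ := .nat)
      (Γ := [.nat]) (.and (.mem .v0 (.const (symmDiffGE i)))
        (.mem (.pair .v1 .v2) (.const ltSet))) ((Env.nil _).cons (a n))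
    obtain ⟨u, x, v, y, hu, hv, h⟩ := exists_pair_of_saturated (P := P) (R := R) fun m => by
      obtain ⟨u, x, v, y, hu, hv, h₁, h₂⟩ := hcon m
      refine ⟨u, x, v, y, hu, hv, fun i hi => (hR i _ _).2 ⟨?_, h₁⟩⟩
      refine (mem_star_symmDiffGE i u v).2 (le_trans ?_ ((mem_star_symmDiffGE _ u v).1 h₂))
      exact_mod_cast by omega
    obtain ⟨k, hk⟩ := finite_iff_exists_not_le_encard.1
      ((hred u x v y hu hv).2 ⟨n, ((hR 0 _ _).1 (h 0)).2⟩)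
    exact hk ((mem_star_symmDiffGE k u v).1 ((hR k _ _).1 (h k)).1)
  obtain ⟨m, hsep⟩ := hsep
  exact false_of_domCubeSet (hP _ _) hlip hsep

end Universe

end NSA

theorem mainTheorem8 (U : NSA.Universe.{u}) :
    (∀ C : Set U.HNat, U.IsAdditive C → U.IsCountablyCofinalCut C →
      NSA.Universe.BorelLE (U.monadic C) U.FD) ∧
    (∀ C : Set U.HNat, U.IsAdditive C → U.IsCountablyCofinalCut C →
      NSA.Universe.BorelLT (U.monadic C) U.FD) ∧
    (∀ C : Set U.HNat, U.IsAdditive C → U.IsCountablyCoinitialCut C →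
      ¬ NSA.Universe.CDLE (U.monadic C) U.FD) :=
  ⟨fun _ hadd hC => NSA.Universe.borelLE_FD hadd hC,
    fun _ hadd hC => ⟨NSA.Universe.borelLE_FD hadd hC, NSA.Universe.not_borelLE_monadic hC⟩,
    fun _ hadd hC => NSA.Universe.not_CDLE_FD hadd hC⟩
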